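/- Let $n,p$ be positive integers. For a positive definite $d\times d$ matrix $\Omega$ put $\omega=\mathrm{diag}(\sqrt{\Omega_{11}},\dots,\sqrt{\Omega_{dd}})$ and $\overline{\Omega}=\omega^{-1}\Omega\omega^{-1}$. For $\Omega$ of size $np\times np$ and $\mathbf M,\mathbf B\in\mathbb R^{n\times p}$, the matrix variate skew-normal distribution $SN_{n\times p}(\mathbf M,\Omega,\mathbf B)$ is the distribution on $\mathbb R^{n\times p}$ with Lebesgue density $$\mathbf Y\mapsto 2\,\phi_{np}(\mathrm{vec}\,\mathbf Y;\mathrm{vec}\,\mathbf M,\Omega)\,\Phi\big((\mathrm{vec}\,\mathbf B)^T\omega^{-1}\mathrm{vec}(\mathbf Y-\mathbf M)\big),$$ where $\mathrm{vec}$ stacks columns, $\phi_{np}(\cdot;\mu,\Omega)$ is the density of $N_{np}(\mu,\Omega)$, and $\Phi$ is the standard normal distribution function. Its parameter $\delta\in\mathbb R^{np}$ is $\delta=(1+\alpha^T\overline\Omega\alpha)^{-1/2}\,\omega\,\overline\Omega\,\alpha$ with $\alpha=\mathrm{vec}\,\mathbf B$, and $SN_{n\times p}(\mathbf M,\Omega,*,\delta)$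 denotes $SN_{n\times p}(\mathbf M,\Omega,\mathbf B)$ for some $\mathbf B$ with parameter $\delta$. A function $f:\mathbb R^{n\times p}\to\mathbb R$ is directionally convex if $\Delta_{k,i}^{\epsilon}\Delta_{l,j}^{\eta}f(\mathbf X)\ge 0$ for all $\mathbf X\in\mathbb R^{n\times p}$, all $1\le k,l\le n$, $1\le i,j\le p$ and all $\epsilon,\eta>0$, where $\Delta_{i,j}^{\epsilon}f(\mathbf X)=f(\mathbf X+\epsilon \mathbf E_{i,j})-f(\mathbf X)$ and $\mathbf E_{i,j}$ is the $(i,j)$-th unit matrix. For random $n\times p$ matrices, $X\le_{dcx}Y$ means that $Ef(X)\le Ef(Y)$ for every measurable directionally convex $f$ for which both expectations exist (that is, $f(X)$ and $f(Y)$ are integrable). **Theorem.** Let $\Omega=\mathbf V\otimes\mathbf\Sigma$ and $\Omega'=\mathbf V'\otimes\mathbf\Sigma'$ with $\mathbf V,\mathbf V'\in\mathbb R^{p\times p}$ and $\mathbf\Sigma,\mathbf\Sigma'\in\mathbb R^{n\times n}$ symmetric positive definite, and let $X_0\sim SN_{n\times p}(\mathbf 0,\overline{\Omega},*,\delta)$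 and $Y_0\sim SN_{n\times p}(\mathbf 0,\overline{\Omega'},*,\delta')$. Then $X_0\le_{dcx}Y_0$ if and only if $\delta=\delta'$ and every entry of $\overline{\Omega'}-\overline{\Omega}$ is nonnegative. -/

import Mathlib

open MeasureTheory ProbabilityTheory
open scoped Matrix Kronecker

/-- Lebesgue measure (and the product σ-algebra) on the space of real matrices. -/
noncomputable instance Matrix.instMeasureSpaceReal {m n : Type*} [Fintype m] [Fintype n] :
    MeasureSpace (Matrix m n ℝ) :=
  inferInstanceAs (MeasureSpace (m → n → ℝ))

namespace SkewNormal

section Vector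

variable {ι : Type*} [Fintype ι] [DecidableEq ι]

/-- The diagonal matrix `ω = diag(√Ω₁₁, …, √Ω_dd)` of standard deviations. -/
noncomputable def stdDev (Ω : Matrix ι ι ℝ) : Matrix ι ι ℝ :=
  Matrix.diagonal fun i => √(Ω i i)

/-- The correlation matrix `Ω̄ = ω⁻¹ Ω ω⁻¹` of a covariance matrix `Ω`. -/
noncomputable def corr (Ω : Matrix ι ι ℝ) : Matrix ι ι ℝ :=
  (stdDev Ω)⁻¹ * Ω * (stdDev Ω)⁻¹

/-- The density `φ_d(z; μ, Ω)` of the multivariate normal distribution `N_d(μ, Ω)`. -/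
noncomputable def normalPDF (μ : ι → ℝ) (Ω : Matrix ι ι ℝ) (z : ι → ℝ) : ℝ :=
  (√((2 * Real.pi) ^ Fintype.card ι * Ω.det))⁻¹ *
    Real.exp (-(1 / 2) * ((z - μ) ⬝ᵥ (Ω⁻¹ *ᵥ (z - μ))))

/-- The density `2 φ_d(z; μ, Ω) Φ(αᵀ ω⁻¹ (z - μ))` of the multivariate skew-normal distribution
`SN_d(μ, Ω, α)`, where `Φ` is the standard normal distribution function. -/
noncomputable def skewNormalPDF (μ : ι → ℝ) (Ω : Matrix ι ι ℝ) (α : ι → ℝ) (z : ι → ℝ) : ℝ :=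
  2 * normalPDF μ Ω z * cdf (gaussianReal 0 1) (α ⬝ᵥ ((stdDev Ω)⁻¹ *ᵥ (z - μ)))

/-- The parameter `δ = (1 + αᵀ Ω̄ α)^{-1/2} ω Ω̄ α` of `SN_d(μ, Ω, α)`. -/
noncomputable def skewDelta (Ω : Matrix ι ι ℝ) (α : ι → ℝ) : ι → ℝ :=
  (√(1 + α ⬝ᵥ (corr Ω *ᵥ α)))⁻¹ • (stdDev Ω *ᵥ (corr Ω *ᵥ α))

end Vector

section RandomMatrix

variable {m n : Type*} [Fintype m] [Fintype n] [DecidableEq m] [DecidableEq n]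

/-- The matrix variate skew-normal law `SN_{m × n}(M, Ω, B)`, with density
`2 φ(vec Y; vec M, Ω) Φ(vec(B)ᵀ ω⁻¹ vec(Y - M))`. Here `vec` stacks the columns, so that `Ω`,
for instance `Ω = V ⊗ Σ` with `V` of size `n × n` and `Σ` of size `m × m`, is indexed by `n × m`. -/
noncomputable def matrixSkewNormal (M : Matrix m n ℝ) (Ω : Matrix (n × m) (n × m) ℝ)
    (B : Matrix m n ℝ) : Measure (Matrix m n ℝ) :=
  volume.withDensity fun Y => ENNReal.ofReal (skewNormalPDF M.vec Ω B.vec Y.vec)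

/-- `X ∼ SN_{m × n}(M, Ω, *, δ)` under the probability measure `P`: the law of `X` is
`SN_{m × n}(M, Ω, B)` for a skewness matrix `B` with associated parameter `δ`. -/
def IsMatrixSkewNormal {S : Type*} [MeasurableSpace S] (X : S → Matrix m n ℝ) (P : Measure S)
    (M : Matrix m n ℝ) (Ω : Matrix (n × m) (n × m) ℝ) (δ : n × m → ℝ) : Prop :=
  ∃ B : Matrix m n ℝ, HasLaw X (matrixSkewNormal M Ω B) P ∧ δ = skewDelta Ω B.vec

/-- The difference operator `Δ_{i,j}^ε f (X) = f (X + ε E_{i,j}) - f X`. -/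
def diffOp (i : m) (j : n) (ε : ℝ) (f : Matrix m n ℝ → ℝ) : Matrix m n ℝ → ℝ :=
  fun X => f (X + ε • Matrix.single i j 1) - f X

/-- Directionally convex functions of a matrix argument. -/
def DirectionallyConvex (f : Matrix m n ℝ → ℝ) : Prop :=
  ∀ (X : Matrix m n ℝ) (k l : m) (i j : n) (ε δ : ℝ), 0 < ε → 0 < δ →
    0 ≤ diffOp k i ε (diffOp l j δ f) X

/-- The integral stochastic order generated by a class `F` of functions: `E f(X) ≤ E f(Y)` for
every measurable `f ∈ F` for which both expectations exist. -/
def IntegralOrder (F : Set (Matrix m n ℝ → ℝ))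
    {S T : Type*} [MeasurableSpace S] [MeasurableSpace T]
    (X : S → Matrix m n ℝ) (P : Measure S) (Y : T → Matrix m n ℝ) (Q : Measure T) : Prop :=
  ∀ f ∈ F, Measurable f → Integrable (fun s => f (X s)) P → Integrable (fun t => f (Y t)) Q →
    ∫ s, f (X s) ∂P ≤ ∫ t, f (Y t) ∂Q

/-- The directionally convex order `X ≤_dcx Y`. -/
def DcxOrder {S T : Type*} [MeasurableSpace S] [MeasurableSpace T]
    (X : S → Matrix m n ℝ) (P : Measure S) (Y : T → Matrix m n ℝ) (Q : Measure T) : Prop :=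
  IntegralOrder {f | DirectionallyConvex f} X P Y Q

end RandomMatrix

end SkewNormal

/-! The Kronecker structure matters only through positive definiteness: a correlation matrix has
unit diagonal, so the scale matrix is the identity and only vector skew-normal laws with unit
variances remain. Such a law has the additive representation `X = tδ + Z`, with `t` half-normal and
`Z` an independent centred normal vector with covariance `Ω - δδᵀ` (`skewLaw_eq_map`).

Necessity follows from the test functions `± x i`, which identify `δ`, and `x i * x j`, which then
compare `Ω` and `Ω'`. For sufficiency, condition on `t`: the translated function is still
directionally convex, and the covariances `Ω - δδᵀ` and `Ω' - δδᵀ` are entrywise ordered with equal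
diagonals. What is left is a Gaussian comparison, `integral_normalLaw_mono`.

That comparison uses no derivatives. Raising one off-diagonal covariance by a small amount is
realised by a coupling that turns the claim into the inequality `h(x+v) + h(x+w) ≤ h(x) + h(x+v+w)`
(`integral_normalLaw_le_add_symmUnit`); finitely many such moves lead from one covariance to the
other.

The difficulty is that `h` is assumed integrable only at the two endpoints, not under the
intermediate laws. Replacing `h` by `h(t·)` with `t < 1` gains room in the Gaussian exponent.
Directional convexity turns local integrals into pointwise bounds, and an ordering of ellipsoids
(`exists_ge_quadForm_inv_le`) transfers growth control from `B` to every `C ≤ B`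
(`DirConvex.exists_abs_le_exp_of_le`). Finally `t → 1` by dominated convergence. -/

namespace SkewNormal

set_option linter.unusedSectionVars false

/-! ### Centred Gaussian laws: characteristic functions and densities -/

section Gaussian

variable {ι κ : Type*} [Fintype ι] [Fintype κ] [DecidableEq ι] [DecidableEq κ]

/-- The standard normal law on `κ → ℝ`. -/
noncomputable def stdNormal (κ : Type*) [Fintype κ] : Measure (κ → ℝ) :=
  Measure.pi fun _ => gaussianReal 0 1

instance isProbabilityMeasure_stdNormal : IsProbabilityMeasure (stdNormal κ) := by
  unfold stdNormal; infer_instance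

lemma dual_apply_eq_sum (φ : StrongDual ℝ (κ → ℝ)) (x : κ → ℝ) :
    φ x = ∑ k, φ (Pi.single k 1) * x k := by
  conv_lhs => rw [← Finset.univ_sum_single x]
  rw [map_sum]
  refine Finset.sum_congr rfl fun k _ => ?_
  rw [show (Pi.single k (x k) : κ → ℝ) = x k • Pi.single k (1 : ℝ) by
    rw [← Pi.single_smul]; simp, map_smul, smul_eq_mul, mul_comm]

lemma charFunDual_stdNormal (φ : StrongDual ℝ (κ → ℝ)) :
    charFunDual (stdNormal κ) φ =
      Complex.exp (((-(∑ k, φ (Pi.single k 1) ^ 2) / 2 : ℝ)) : ℂ) := by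
  rw [charFunDual_apply, stdNormal]
  have h : ∀ x : κ → ℝ, Complex.exp (φ x * Complex.I) =
      ∏ k, Complex.exp (((φ (Pi.single k 1) * x k : ℝ) : ℂ) * Complex.I) := fun x => by
    rw [dual_apply_eq_sum φ, Complex.ofReal_sum, Finset.sum_mul, Complex.exp_sum]
  simp_rw [h]
  rw [integral_fintype_prod_eq_prod (f := fun k (x : ℝ) =>
    Complex.exp (((φ (Pi.single k 1) * x : ℝ) : ℂ) * Complex.I))]
  simp_rw [Complex.ofReal_mul, ← charFun_apply_real, charFun_gaussianReal]
  rw [← Complex.exp_sum]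
  congr 1
  push_cast
  simp only [mul_zero, zero_mul, one_mul, zero_sub, Finset.sum_neg_distrib, ← Finset.sum_div]
  ring

lemma exists_symm_sq_eq {C : Matrix ι ι ℝ} (hC : C.PosSemidef) :
    ∃ L : Matrix ι ι ℝ, Lᵀ = L ∧ L * L = C := by
  open scoped MatrixOrder in
  refine ⟨CFC.sqrt C, ?_, CFC.sqrt_mul_sqrt_self C hC.nonneg⟩
  exact (Matrix.nonneg_iff_posSemidef.mp (CFC.sqrt_nonneg C)).isHermitian

/-- A symmetric square root of a positive semidefinite matrix. -/
noncomputable def symmSqrt (C : Matrix ι ι ℝ) : Matrix ι ι ℝ :=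
  open scoped Classical in
  if hC : C.PosSemidef then (exists_symm_sq_eq hC).choose else 0

lemma symmSqrt_transpose (C : Matrix ι ι ℝ) : (symmSqrt C)ᵀ = symmSqrt C := by
  unfold symmSqrt
  split_ifs with hC
  · exact (exists_symm_sq_eq hC).choose_spec.1
  · simp

lemma symmSqrt_mul_self {C : Matrix ι ι ℝ} (hC : C.PosSemidef) :
    symmSqrt C * symmSqrt C = C := by
  rw [symmSqrt, dif_pos hC]
  exact (exists_symm_sq_eq hC).choose_spec.2

/-- The centred normal law on `ι → ℝ` with (positive semidefinite) covariance matrix `C`. -/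
noncomputable def normalLaw (C : Matrix ι ι ℝ) : Measure (ι → ℝ) :=
  (stdNormal ι).map fun g => symmSqrt C *ᵥ g

lemma measurable_mulVec (L : Matrix ι κ ℝ) : Measurable fun g : κ → ℝ => L *ᵥ g :=
  (Continuous.matrix_mulVec continuous_const continuous_id).measurable

instance isProbabilityMeasure_normalLaw (C : Matrix ι ι ℝ) :
    IsProbabilityMeasure (normalLaw C) :=
  Measure.isProbabilityMeasure_map (measurable_mulVec _).aemeasurable

lemma charFunDual_normalLaw {C : Matrix ι ι ℝ} (hC : C.PosSemidef) (φ : StrongDual ℝ (ι → ℝ)) :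
    charFunDual (normalLaw C) φ = Complex.exp ((-((fun i => φ (Pi.single i 1)) ⬝ᵥ
      (C *ᵥ fun i => φ (Pi.single i 1))) / 2 : ℝ) : ℂ) := by
  have h : (fun g => symmSqrt C *ᵥ g) =
      ⇑(LinearMap.toContinuousLinearMap (Matrix.toLin' (symmSqrt C))) := by
    ext g; simp
  rw [normalLaw, h, charFunDual_map, charFunDual_stdNormal]
  congr 4
  set c : ι → ℝ := fun i => φ (Pi.single i 1)
  have h2 : ∀ k, (φ.comp (LinearMap.toContinuousLinearMap (Matrix.toLin' (symmSqrt C))))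
      (Pi.single k 1) = (symmSqrt C *ᵥ c) k := by
    intro k
    simp only [ContinuousLinearMap.comp_apply, LinearMap.coe_toContinuousLinearMap',
      Matrix.toLin'_apply]
    rw [dual_apply_eq_sum φ]
    conv_rhs => rw [← symmSqrt_transpose C]
    simp [Matrix.mulVec, dotProduct, c, mul_comm, Pi.single_apply]
  simp_rw [h2]
  conv_rhs => rw [← symmSqrt_mul_self hC, ← Matrix.mulVec_mulVec, Matrix.dotProduct_mulVec]
  conv_rhs => rw [← Matrix.mulVec_transpose, symmSqrt_transpose]
  simp [dotProduct, sq]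

lemma stdNormal_eq_withDensity : stdNormal κ = volume.withDensity fun x : κ → ℝ =>
    ENNReal.ofReal ((√((2 * Real.pi) ^ Fintype.card κ))⁻¹ * Real.exp (-(1 / 2) * (x ⬝ᵥ x))) := by
  have hd : ∀ x : κ → ℝ, (√((2 * Real.pi) ^ Fintype.card κ))⁻¹ *
      Real.exp (-(1 / 2) * (x ⬝ᵥ x)) = ∏ k, gaussianPDFReal 0 1 (x k) := by
    intro x
    simp only [gaussianPDFReal, Finset.prod_mul_distrib, ← Real.exp_sum, Finset.prod_const,
      Finset.card_univ, NNReal.coe_one, mul_one, sub_zero, inv_pow]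
    congr 2
    · rw [Real.sqrt_eq_rpow, Real.sqrt_eq_rpow, ← Real.rpow_natCast, ← Real.rpow_natCast,
        ← Real.rpow_mul (by positivity), ← Real.rpow_mul (by positivity), mul_comm (1 / 2 : ℝ)]
    · rw [dotProduct, Finset.mul_sum]
      exact Finset.sum_congr rfl fun k _ => by ring
  simp_rw [hd]
  refine Measure.pi_eq fun s hs => ?_
  rw [withDensity_apply _ (MeasurableSet.univ_pi hs), volume_pi, Measure.restrict_pi_pi,
    ← ofReal_integral_eq_lintegral_ofReal]
  · rw [integral_fintype_prod_eq_prod, ENNReal.ofReal_prod_of_nonneg]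
    · refine Finset.prod_congr rfl fun k _ => ?_
      rw [gaussianReal_apply_eq_integral _ one_ne_zero]
    · exact fun k _ => integral_nonneg fun x => gaussianPDFReal_nonneg _ _ _
  · exact Integrable.fintype_prod fun k => (integrable_gaussianPDFReal 0 1).restrict
  · exact ae_of_all _ fun x => Finset.prod_nonneg fun k _ => gaussianPDFReal_nonneg _ _ _

lemma withDensity_map_of_leftInverse {α β : Type*} [MeasurableSpace α] [MeasurableSpace β]
    {μ : Measure α} {T : α → β} {S : β → α} (hT : Measurable T) (hS : Measurable S)
    (hST : ∀ x, S (T x) = x) {d : α → ENNReal} (hd : Measurable d) :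
    (μ.withDensity d).map T = (μ.map T).withDensity (d ∘ S) := by
  ext s hs
  rw [Measure.map_apply hT hs, withDensity_apply _ (hT hs), withDensity_apply _ hs,
    setLIntegral_map hs (hd.comp hS) hT]
  simp [hST]

lemma symmSqrt_det_ne_zero {C : Matrix ι ι ℝ} (hC : C.PosDef) : (symmSqrt C).det ≠ 0 := by
  intro h
  have := hC.det_pos
  rw [← symmSqrt_mul_self hC.posSemidef, Matrix.det_mul, h] at this
  simp at this

lemma dotProduct_inv_mulVec_symmSqrt {C : Matrix ι ι ℝ} (hC : C.PosDef) (g : ι → ℝ) :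
    (symmSqrt C *ᵥ g) ⬝ᵥ (C⁻¹ *ᵥ (symmSqrt C *ᵥ g)) = g ⬝ᵥ g := by
  have hu : IsUnit (symmSqrt C).det := (symmSqrt_det_ne_zero hC).isUnit
  conv_lhs => rw [show C⁻¹ = (symmSqrt C)⁻¹ * (symmSqrt C)⁻¹ by
    rw [← Matrix.mul_inv_rev, symmSqrt_mul_self hC.posSemidef]]
  rw [Matrix.mulVec_mulVec, Matrix.mul_assoc, Matrix.nonsing_inv_mul _ hu, Matrix.mul_one,
    Matrix.dotProduct_mulVec, ← Matrix.mulVec_transpose, Matrix.transpose_nonsing_inv,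
    symmSqrt_transpose, Matrix.mulVec_mulVec, Matrix.nonsing_inv_mul _ hu, Matrix.one_mulVec]

/-- Linear change of variables by the symmetric square root. Couplings are checked on characteristic
functions; the density serves the integrability estimates and the passage to the skew-normal
density. -/
lemma normalLaw_eq_withDensity {C : Matrix ι ι ℝ} (hC : C.PosDef) :
    normalLaw C = volume.withDensity fun z => ENNReal.ofReal (normalPDF 0 C z) := by
  have hne := symmSqrt_det_ne_zero hC
  have hu : IsUnit (symmSqrt C).det := hne.isUnit
  have hST : ∀ x, (symmSqrt C)⁻¹ *ᵥ (symmSqrt C *ᵥ x) = x := fun x => by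
    rw [Matrix.mulVec_mulVec, Matrix.nonsing_inv_mul _ hu, Matrix.one_mulVec]
  have hTS : ∀ x, symmSqrt C *ᵥ ((symmSqrt C)⁻¹ *ᵥ x) = x := fun x => by
    rw [Matrix.mulVec_mulVec, Matrix.mul_nonsing_inv _ hu, Matrix.one_mulVec]
  have hvol : Measure.map (fun g => symmSqrt C *ᵥ g) (volume : Measure (ι → ℝ)) =
      ENNReal.ofReal |(symmSqrt C).det⁻¹| • volume := by
    rw [← Real.map_matrix_volume_pi_eq_smul_volume_pi hne]
    congr 1
  rw [normalLaw, stdNormal_eq_withDensity, withDensity_map_of_leftInverse (measurable_mulVec _)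
    (measurable_mulVec _) hST (by fun_prop), hvol, withDensity_smul_measure,
    ← withDensity_smul _ (by fun_prop)]
  congr 1
  ext z
  obtain ⟨g, rfl⟩ : ∃ g, z = symmSqrt C *ᵥ g := ⟨_, (hTS z).symm⟩
  simp only [Pi.smul_apply, Function.comp_apply, hST, smul_eq_mul, normalPDF, sub_zero,
    dotProduct_inv_mulVec_symmSqrt hC]
  rw [← ENNReal.ofReal_mul (abs_nonneg _), ← mul_assoc]
  congr 2
  rw [Real.sqrt_mul (by positivity), mul_inv, mul_comm]
  congr 1
  rw [← symmSqrt_mul_self hC.posSemidef, Matrix.det_mul, Real.sqrt_mul_self_eq_abs, abs_inv]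
  rw [symmSqrt_mul_self hC.posSemidef]

end Gaussian

/-! ### Quadratic forms and comparison of ellipsoids -/

section QuadraticForm

variable {ι : Type*} [Fintype ι] [DecidableEq ι]

/-- The quadratic form `x ↦ xᵀ P x`. -/
def quadForm (P : Matrix ι ι ℝ) (x : ι → ℝ) : ℝ := x ⬝ᵥ (P *ᵥ x)

lemma quadForm_nonneg {P : Matrix ι ι ℝ} (hP : P.PosSemidef) (x : ι → ℝ) : 0 ≤ quadForm P x := by
  simpa [quadForm] using hP.dotProduct_mulVec_nonneg x

lemma quadForm_smul (P : Matrix ι ι ℝ) (t : ℝ) (x : ι → ℝ) :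
    quadForm P (t • x) = t ^ 2 * quadForm P x := by
  simp [quadForm, Matrix.mulVec_smul]; ring

lemma quadForm_neg (P : Matrix ι ι ℝ) (x : ι → ℝ) : quadForm P (-x) = quadForm P x := by
  simp [quadForm, Matrix.mulVec_neg]

lemma dotProduct_mulVec_comm_of_isHermitian {P : Matrix ι ι ℝ} (hP : P.IsHermitian)
    (x y : ι → ℝ) : x ⬝ᵥ (P *ᵥ y) = y ⬝ᵥ (P *ᵥ x) := by
  have hT : Pᵀ = P := hP
  rw [dotProduct_comm y, ← Matrix.dotProduct_transpose_mulVec, hT]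
  exact dotProduct_comm _ _

lemma quadForm_add {P : Matrix ι ι ℝ} (hP : P.IsHermitian) (x y : ι → ℝ) :
    quadForm P (x + y) = quadForm P x + 2 * (y ⬝ᵥ (P *ᵥ x)) + quadForm P y := by
  simp only [quadForm, Matrix.mulVec_add, dotProduct_add, add_dotProduct]
  rw [dotProduct_mulVec_comm_of_isHermitian hP x y]; ring

/-- Young's inequality for the cross term, from nonnegativity of the form at `η • x - y`. -/
lemma quadForm_add_le {P : Matrix ι ι ℝ} (hP : P.PosSemidef) {η : ℝ} (hη : 0 < η) (x y : ι → ℝ) :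
    quadForm P (x + y) ≤ (1 + η) * quadForm P x + (1 + 1 / η) * quadForm P y := by
  have h := quadForm_nonneg hP (η • x + -y)
  rw [quadForm_add hP.isHermitian, quadForm_smul, quadForm_neg, Matrix.mulVec_smul,
    neg_dotProduct, dotProduct_smul, smul_eq_mul] at h
  rw [quadForm_add hP.isHermitian]
  have h2 : 2 * (y ⬝ᵥ (P *ᵥ x)) ≤ η * quadForm P x + 1 / η * quadForm P y := by
    have : η * (2 * (y ⬝ᵥ (P *ᵥ x))) ≤ η * (η * quadForm P x + 1 / η * quadForm P y) := by
      have e : η * (η * quadForm P x + 1 / η * quadForm P y) =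
        η ^ 2 * quadForm P x + quadForm P y := by field_simp
      rw [e]; linarith
    exact le_of_mul_le_mul_left this hη
  linarith

lemma exists_quadForm_le_dotProduct (P : Matrix ι ι ℝ) :
    ∃ K, 0 < K ∧ ∀ x, quadForm P x ≤ K * (x ⬝ᵥ x) := by
  refine ⟨1 + ∑ i, ∑ j, |P i j|, by positivity, fun x => ?_⟩
  have hx : ∀ i, x i ^ 2 ≤ x ⬝ᵥ x := fun i => by
    simp only [dotProduct, ← sq]
    exact Finset.single_le_sum (f := fun i => x i ^ 2) (fun j _ => sq_nonneg _) (Finset.mem_univ i)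
  have h0 : 0 ≤ x ⬝ᵥ x := by simpa [dotProduct] using Finset.sum_nonneg fun i _ => mul_self_nonneg (x i)
  have h : quadForm P x ≤ (∑ i, ∑ j, |P i j|) * (x ⬝ᵥ x) := by
    generalize x ⬝ᵥ x = d at hx
    simp only [quadForm, dotProduct, Matrix.mulVec, Finset.mul_sum, Finset.sum_mul]
    refine Finset.sum_le_sum fun i _ => ?_
    refine Finset.sum_le_sum fun j _ => ?_
    have h1 : x i * x j ≤ d ∧ -(x i * x j) ≤ d := by
      constructor <;> nlinarith [hx i, hx j, sq_nonneg (x i - x j), sq_nonneg (x i + x j)]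
    calc x i * (P i j * x j) = P i j * (x i * x j) := by ring
      _ ≤ |P i j * (x i * x j)| := le_abs_self _
      _ = |P i j| * |x i * x j| := abs_mul _ _
      _ ≤ |P i j| * d := by
        gcongr; exact abs_le'.2 h1
  linarith

lemma exists_symmSqrt_mulVec_eq {C : Matrix ι ι ℝ} (hC : C.PosDef) (x : ι → ℝ) :
    ∃ g, symmSqrt C *ᵥ g = x := by
  refine ⟨(symmSqrt C)⁻¹ *ᵥ x, ?_⟩
  rw [Matrix.mulVec_mulVec, Matrix.mul_nonsing_inv _ (symmSqrt_det_ne_zero hC).isUnit,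
    Matrix.one_mulVec]

lemma exists_dotProduct_le_quadForm_inv {C : Matrix ι ι ℝ} (hC : C.PosDef) :
    ∃ K, 0 < K ∧ ∀ x, x ⬝ᵥ x ≤ K * quadForm C⁻¹ x := by
  obtain ⟨K, hK, h⟩ := exists_quadForm_le_dotProduct C
  refine ⟨K, hK, fun x => ?_⟩
  obtain ⟨g, rfl⟩ := exists_symmSqrt_mulVec_eq hC x
  rw [show quadForm C⁻¹ (symmSqrt C *ᵥ g) = g ⬝ᵥ g from dotProduct_inv_mulVec_symmSqrt hC g]
  refine le_trans (le_of_eq ?_) (h g)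
  rw [quadForm, ← symmSqrt_mul_self hC.posSemidef, ← Matrix.mulVec_mulVec,
    ← Matrix.dotProduct_transpose_mulVec, symmSqrt_transpose]
  rw [symmSqrt_mul_self hC.posSemidef]

/-- Entrywise domination of the covariance `C` by `B` makes every point of an ellipsoid of `C` lie
below a point of the corresponding ellipsoid of `B`. -/
lemma exists_ge_quadForm_inv_le {B C : Matrix ι ι ℝ} (hB : B.PosDef) (hC : C.PosDef)
    (hCB : ∀ i j, C i j ≤ B i j) (z : ι → ℝ) :
    ∃ y, z ≤ y ∧ quadForm B⁻¹ y ≤ quadForm C⁻¹ z := by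
  have hBi := hB.inv
  have hcont : Continuous fun y => quadForm B⁻¹ y := by unfold quadForm; fun_prop
  obtain ⟨K, hK, hKb⟩ := exists_dotProduct_le_quadForm_inv hB
  set R := K * quadForm B⁻¹ z
  have hcomp : IsCompact {y | z ≤ y ∧ quadForm B⁻¹ y ≤ quadForm B⁻¹ z} := by
    refine IsCompact.of_isClosed_subset (isCompact_Icc (a := fun _ : ι => -√R) (b := fun _ => √R))
      ((isClosed_Ici).inter (isClosed_le hcont continuous_const)) ?_
    rintro y ⟨-, hy⟩
    have : ∀ i, |y i| ≤ √R := fun i => by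
      refine Real.abs_le_sqrt ?_
      have h1 : y i ^ 2 ≤ y ⬝ᵥ y := by
        simp only [dotProduct, ← sq]
        exact Finset.single_le_sum (f := fun i => y i ^ 2) (fun j _ => sq_nonneg _)
          (Finset.mem_univ i)
      exact h1.trans ((hKb y).trans (mul_le_mul_of_nonneg_left hy hK.le))
    exact ⟨fun i => (abs_le.1 (this i)).1, fun i => (abs_le.1 (this i)).2⟩
  -- The witness minimises the form of `B⁻¹` over the orthant above `z`; its optimality conditions,
  -- with multiplier `M = B⁻¹ y`, give the bound.
  obtain ⟨y, ⟨hzy, hyz⟩, hmin⟩ := hcomp.exists_isMinOn ⟨z, le_rfl, le_rfl⟩ hcont.continuousOn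
  have hmin' : ∀ w, z ≤ w → quadForm B⁻¹ y ≤ quadForm B⁻¹ w := fun w hw => by
    by_cases h : quadForm B⁻¹ w ≤ quadForm B⁻¹ z
    · exact hmin ⟨hw, h⟩
    · exact hyz.trans (not_le.1 h).le
  set M := B⁻¹ *ᵥ y with hM
  -- First-order condition in feasible directions. Coordinate directions give `M ≥ 0`, and the
  -- direction `z - y` gives half of complementary slackness.
  have hvar : ∀ v : ι → ℝ, (∀ t : ℝ, 0 < t → t ≤ 1 → z ≤ y + t • v) → 0 ≤ v ⬝ᵥ M := by
    intro v hv
    by_contra! hneg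
    set q := quadForm B⁻¹ v
    have hq : 0 ≤ q := quadForm_nonneg hBi.posSemidef v
    set t : ℝ := min 1 (-(v ⬝ᵥ M) / (q + 1))
    have ht : 0 < t := lt_min one_pos (div_pos (by linarith) (by linarith))
    have h1 := hmin' _ (hv t ht (min_le_left _ _))
    rw [quadForm_add hBi.isHermitian, quadForm_smul, smul_dotProduct, ← hM, smul_eq_mul] at h1
    have h2 : t * (q + 1) ≤ -(v ⬝ᵥ M) := by
      rw [← le_div_iff₀ (by linarith)]; exact min_le_right _ _
    nlinarith
  have hMnn : ∀ i, 0 ≤ M i := fun i => by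
    have := hvar (Pi.single i 1) fun t ht _ => by
      refine hzy.trans (le_add_of_nonneg_right ?_)
      exact smul_nonneg ht.le (Pi.single_nonneg.2 zero_le_one)
    simpa using this
  have hMy : quadForm B⁻¹ y ≤ z ⬝ᵥ M := by
    have := hvar (z - y) fun t ht ht1 i => by
      have := hzy i
      simp only [Pi.add_apply, Pi.smul_apply, Pi.sub_apply, smul_eq_mul]
      nlinarith
    rw [sub_dotProduct] at this
    simpa [quadForm, hM] using this
  have hBM : quadForm B M = quadForm B⁻¹ y := by
    rw [quadForm, hM, Matrix.mulVec_mulVec, Matrix.mul_nonsing_inv _ hB.det_pos.ne'.isUnit,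
      Matrix.one_mulVec, dotProduct_comm, quadForm]
  -- Entrywise domination enters here, and it needs the signs `M ≥ 0`.
  have hCM : quadForm C M ≤ quadForm B M := by
    simp only [quadForm, dotProduct, Matrix.mulVec]
    refine Finset.sum_le_sum fun i _ => mul_le_mul_of_nonneg_left ?_ (hMnn i)
    exact Finset.sum_le_sum fun j _ => mul_le_mul_of_nonneg_right (hCB i j) (hMnn j)
  have hCz : C *ᵥ (C⁻¹ *ᵥ z) = z := by
    rw [Matrix.mulVec_mulVec, Matrix.mul_nonsing_inv _ hC.det_pos.ne'.isUnit, Matrix.one_mulVec]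
  -- Completing the square: `2 z·M ≤ MᵀCM + zᵀC⁻¹z`. The first term on the right is at most
  -- `yᵀB⁻¹y`, which is itself at most `z·M`.
  have hsq := quadForm_nonneg hC.posSemidef (M + -(C⁻¹ *ᵥ z))
  rw [quadForm_add hC.isHermitian, quadForm_neg, neg_dotProduct,
    dotProduct_mulVec_comm_of_isHermitian hC.isHermitian, hCz, quadForm, quadForm, hCz,
    dotProduct_comm M z, dotProduct_comm _ z] at hsq
  refine ⟨y, hzy, ?_⟩
  simp only [quadForm] at *
  linarith

lemma exists_quadForm_inv_le {B C : Matrix ι ι ℝ} (hC : C.PosDef) :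
    ∃ K, 0 < K ∧ ∀ x, quadForm B⁻¹ x ≤ K * quadForm C⁻¹ x := by
  obtain ⟨K, hK, h⟩ := exists_quadForm_le_dotProduct B⁻¹
  obtain ⟨K', hK', h'⟩ := exists_dotProduct_le_quadForm_inv hC
  refine ⟨K * K', by positivity, fun x => (h x).trans ?_⟩
  rw [mul_assoc]
  exact mul_le_mul_of_nonneg_left (h' x) hK.le

end QuadraticForm

/-! ### Directionally convex functions: extrapolation and local bounds -/

section DirConvex

variable {ι : Type*} [Fintype ι] [DecidableEq ι]

/-- Directional convexity of a function of a vector argument, for arbitrary nonnegative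
directions. -/
def DirConvex (h : (ι → ℝ) → ℝ) : Prop :=
  ∀ x v w : ι → ℝ, 0 ≤ v → 0 ≤ w → h (x + v) + h (x + w) ≤ h x + h (x + v + w)

lemma sum_induction_nonneg {p : (ι → ℝ) → Prop} (h0 : p 0) (hadd : ∀ v w, p v → p w → p (v + w))
    (hsingle : ∀ i (ε : ℝ), 0 < ε → p (Pi.single i ε)) {v : ι → ℝ} (hv : 0 ≤ v) : p v := by
  rw [← Finset.univ_sum_single v]
  refine Finset.sum_induction _ p hadd h0 fun i _ => ?_
  rcases (hv i).eq_or_lt with h | h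
  · rw [← h]; simpa using h0
  · exact hsingle i _ h

/-- Mixed second differences telescope in each increment separately, so coordinate increments
suffice. -/
lemma dirConvex_of_single {h : (ι → ℝ) → ℝ}
    (hh : ∀ x (i j : ι) (ε δ : ℝ), 0 < ε → 0 < δ →
      h (x + Pi.single i ε) + h (x + Pi.single j δ) ≤
        h x + h (x + Pi.single i ε + Pi.single j δ)) : DirConvex h := by
  intro x v w hv hw
  have key : ∀ j (δ : ℝ), 0 < δ → ∀ x, h (x + v) + h (x + Pi.single j δ) ≤
      h x + h (x + v + Pi.single j δ) := by
    intro j δ hδ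
    refine sum_induction_nonneg (p := fun v => ∀ x, h (x + v) + h (x + Pi.single j δ) ≤
      h x + h (x + v + Pi.single j δ)) (by simp) ?_ ?_ hv
    · intro v v' h1 h2 x
      have a := h1 x
      have b := h2 (x + v)
      rw [add_assoc x v v'] at b
      linarith
    · exact fun i ε hε x => hh x i j ε δ hε hδ
  refine sum_induction_nonneg (p := fun w => ∀ x, h (x + v) + h (x + w) ≤
      h x + h (x + v + w)) (by simp [add_comm]) ?_ (fun j δ hδ => key j δ hδ) hw x
  intro w w' h1 h2 x
  have a := h1 x
  have b := h2 (x + w)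
  rw [show x + w + v + w' = x + v + (w + w') by abel, show x + w + v = x + v + w by abel,
    add_assoc x w w'] at b
  linarith

namespace DirConvex

variable {h : (ι → ℝ) → ℝ}

lemma comp_add_left (hh : DirConvex h) (a : ι → ℝ) : DirConvex fun x => h (a + x) := by
  intro x v w hv hw
  simpa [add_assoc] using hh (a + x) v w hv hw

lemma comp_smul (hh : DirConvex h) {t : ℝ} (ht : 0 ≤ t) : DirConvex fun x => h (t • x) := by
  intro x v w hv hw
  simpa [smul_add] using hh (t • x) (t • v) (t • w) (smul_nonneg ht hv) (smul_nonneg ht hw)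

/-- Along a nonnegative direction the increments of `h` increase, so `h` lies below its chord from
`z` to `z + (n + 1) s`. Continuity is not needed because only lattice points occur. -/
lemma extrapolate (hh : DirConvex h) (z : ι → ℝ) {s : ι → ℝ} (hs : 0 ≤ s) (n : ℕ) :
    (n + 1) * h (z + (n : ℝ) • s) ≤ h z + n * h (z + (n : ℝ) • s + s) := by
  induction n with
  | zero => simp
  | succ n ih =>
    have e : z + ((n + 1 : ℕ) : ℝ) • s = z + (n : ℝ) • s + s := by
      push_cast; rw [add_smul, one_smul, add_assoc]
    rw [e]
    have := hh (z + (n : ℝ) • s) s s hs hs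
    push_cast
    have h2 := mul_le_mul_of_nonneg_left this (by positivity : (0 : ℝ) ≤ n + 1)
    linarith

/-- Extrapolation along a nonnegative direction beyond a point `z + s`. -/
lemma extrapolate_div (hh : DirConvex h) (z : ι → ℝ) {s : ι → ℝ} (hs : 0 ≤ s) {n : ℕ}
    (hn : 0 < n) : (n + 1) * h (z + s) ≤ h z + n * h (z + s + (1 / n : ℝ) • s) := by
  have := hh.extrapolate z (s := (1 / n : ℝ) • s) (smul_nonneg (by positivity) hs) n
  rwa [smul_smul, mul_one_div_cancel (by positivity), one_smul] at this

lemma two_mul_le (hh : DirConvex h) (z : ι → ℝ) {s : ι → ℝ} (hs : 0 ≤ s) :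
    2 * h z ≤ h (z + s) + h (z - s) := by
  have := hh (z - s) s s hs hs
  simp only [sub_add_cancel] at this
  linarith

lemma setIntegral_comp_add_left (f : (ι → ℝ) → ℝ) (z : ι → ℝ) :
    ∫ s in Set.Icc 0 1, f (z + s) = ∫ x in Set.Icc z (z + 1), f x := by
  have := (measurePreserving_add_left (volume : Measure (ι → ℝ)) z).setIntegral_preimage_emb
    (MeasurableEquiv.addLeft z).measurableEmbedding f (Set.Icc z (z + 1))
  rw [← this]
  congr 2
  ext s; simp

lemma setIntegral_comp_sub_left (f : (ι → ℝ) → ℝ) (z : ι → ℝ) :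
    ∫ s in Set.Icc 0 1, f (z - s) = ∫ x in Set.Icc (z - 1) z, f x := by
  have := (Measure.measurePreserving_sub_left (volume : Measure (ι → ℝ)) z).setIntegral_preimage_emb
    (MeasurableEquiv.subLeft z).measurableEmbedding f (Set.Icc (z - 1) z)
  rw [← this]
  congr 2
  ext s; simp

lemma integrableOn_comp_add_left {f : (ι → ℝ) → ℝ} (z : ι → ℝ)
    (hf : IntegrableOn f (Set.Icc z (z + 1))) : IntegrableOn (fun s => f (z + s)) (Set.Icc 0 1) := by
  have := ((measurePreserving_add_left (volume : Measure (ι → ℝ)) z).integrableOn_comp_preimage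
    (MeasurableEquiv.addLeft z).measurableEmbedding).2 hf
  convert! this using 1
  ext s; simp

lemma integrableOn_comp_sub_left {f : (ι → ℝ) → ℝ} (z : ι → ℝ)
    (hf : IntegrableOn f (Set.Icc (z - 1) z)) : IntegrableOn (fun s => f (z - s)) (Set.Icc 0 1) := by
  have := ((Measure.measurePreserving_sub_left (volume : Measure (ι → ℝ)) z).integrableOn_comp_preimage
    (MeasurableEquiv.subLeft z).measurableEmbedding).2 hf
  convert! this using 1
  ext s; simp

lemma volume_real_Icc_zero_one : (volume : Measure (ι → ℝ)).real (Set.Icc 0 1) = 1 := by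
  simp [Measure.real, Real.volume_Icc_pi]

/-- The midpoint inequality `2 h(z) ≤ h(z+s) + h(z-s)` is averaged over `s` in the unit cube. -/
lemma le_setIntegral (hh : DirConvex h) (hint : ∀ a b, IntegrableOn h (Set.Icc a b))
    (z : ι → ℝ) : h z ≤ ∫ x in Set.Icc (z - 1) (z + 1), |h x| := by
  have habs : ∀ a b, IntegrableOn (fun x => |h x|) (Set.Icc a b) := fun a b => (hint a b).abs
  have hcI : IntegrableOn (fun _ : ι → ℝ => h z) (Set.Icc 0 1) :=
    integrableOn_const (by simp [Real.volume_Icc_pi])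
  have hz : h z = ∫ _s : ι → ℝ in Set.Icc 0 1, h z := by
    rw [setIntegral_const, volume_real_Icc_zero_one, one_smul]
  have ha := integrableOn_comp_add_left z (habs z (z + 1))
  have hb := integrableOn_comp_sub_left z (habs (z - 1) z)
  have h1 : 2 * h z ≤ ∫ s in Set.Icc 0 1, (|h (z + s)| + |h (z - s)|) := by
    conv_lhs => rw [hz, ← integral_const_mul]
    refine setIntegral_mono_on (hcI.const_mul 2) (ha.add hb) measurableSet_Icc fun s hs => ?_
    exact (hh.two_mul_le z hs.1).trans (add_le_add (le_abs_self _) (le_abs_self _))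
  rw [integral_add ha hb, setIntegral_comp_add_left (fun x => |h x|),
    setIntegral_comp_sub_left (fun x => |h x|)] at h1
  have h01 : (0 : ι → ℝ) ≤ 1 := zero_le_one
  have h2 := setIntegral_mono_set (habs (z - 1) (z + 1)) (ae_of_all _ fun x => abs_nonneg (h x))
    (Set.Icc_subset_Icc_left (sub_le_self z h01)).eventuallyLE
  have h3 := setIntegral_mono_set (habs (z - 1) (z + 1)) (ae_of_all _ fun x => abs_nonneg (h x))
    (Set.Icc_subset_Icc_right (le_add_of_nonneg_right h01)).eventuallyLE
  linarith

/-- For the lower bound, average `2 h(z+s) ≤ h(z) + h(z+2s)` over the unit cube, with the last term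
controlled by `le_setIntegral`. Since `z + 2s` moves by at most 2 and that lemma uses a margin of 1,
a box of half-width 3 suffices. -/
lemma abs_le_setIntegral (hh : DirConvex h) (hint : ∀ a b, IntegrableOn h (Set.Icc a b))
    (z : ι → ℝ) : |h z| ≤ 3 * ∫ x in Set.Icc (z - 3) (z + 3), |h x| := by
  have habs : ∀ a b, IntegrableOn (fun x => |h x|) (Set.Icc a b) := fun a b => (hint a b).abs
  have hmono : ∀ a b, z - 3 ≤ a → b ≤ z + 3 →
      ∫ x in Set.Icc a b, |h x| ≤ ∫ x in Set.Icc (z - 3) (z + 3), |h x| := fun a b hab hb =>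
    setIntegral_mono_set (habs _ _) (ae_of_all _ fun x => abs_nonneg (h x))
      (Set.Icc_subset_Icc hab hb).eventuallyLE
  have hnn : 0 ≤ ∫ x in Set.Icc (z - 3) (z + 3), |h x| :=
    setIntegral_nonneg measurableSet_Icc fun x _ => abs_nonneg _
  set J := ∫ x in Set.Icc (z - 3) (z + 3), |h x|
  have hup : ∀ s : ι → ℝ, 0 ≤ s → s ≤ 1 → h (z + s + s) ≤ J := fun s hs hs1 =>
    (hh.le_setIntegral hint _).trans (hmono _ _
      (fun i => by
        have := hs i
        simp only [Pi.sub_apply, Pi.add_apply, Pi.ofNat_apply] at *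
        linarith)
      (fun i => by
        have := hs1 i
        simp only [Pi.add_apply, Pi.ofNat_apply] at *
        linarith))
  have hcI : ∀ c : ℝ, IntegrableOn (fun _ : ι → ℝ => c) (Set.Icc 0 1) := fun c =>
    integrableOn_const (by simp [Real.volume_Icc_pi])
  have hz : ∀ c : ℝ, c = ∫ _s : ι → ℝ in Set.Icc 0 1, c := fun c => by
    rw [setIntegral_const, volume_real_Icc_zero_one, one_smul]
  have ha := integrableOn_comp_add_left z (habs z (z + 1))
  have h1 : -h z - J ≤ ∫ s in Set.Icc 0 1, 2 * |h (z + s)| := by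
    conv_lhs => rw [hz (-h z - J)]
    refine setIntegral_mono_on (hcI _) (ha.const_mul 2) measurableSet_Icc fun s hs => ?_
    have a := hh z s s hs.1 hs.1
    have b := hup s hs.1 hs.2
    have c := neg_abs_le (h (z + s))
    linarith
  rw [integral_const_mul, setIntegral_comp_add_left (fun x => |h x|)] at h1
  have h2 := hmono z (z + 1) (fun i => by simp) (fun i => by
    simp only [Pi.add_apply, Pi.ofNat_apply]; linarith)
  have h3 := hup 0 le_rfl zero_le_one
  simp only [add_zero] at h3
  exact abs_le.2 ⟨by linarith, by linarith⟩

end DirConvex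

end DirConvex

/-! ### Growth bounds and integrability under dominated covariances -/

section Growth

variable {ι : Type*} [Fintype ι] [DecidableEq ι] {h : (ι → ℝ) → ℝ}

lemma continuous_quadForm (P : Matrix ι ι ℝ) : Continuous (quadForm P) := by
  unfold quadForm; fun_prop

/-- On the box around `z` that bounds `|h z|`, the weight is comparable with its value at `z` up to
a constant and an arbitrarily small loss `η` in the exponent. -/
lemma DirConvex.exists_abs_le_exp (hh : DirConvex h) {P : Matrix ι ι ℝ} (hP : P.PosSemidef)
    {κ η : ℝ} (hκ : 0 ≤ κ) (hη : 0 < η)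
    (hint : Integrable fun x => h x * Real.exp (-(κ / 2 * quadForm P x))) :
    ∃ K, 0 ≤ K ∧ ∀ z, |h z| ≤ K * Real.exp (κ * (1 + η) / 2 * quadForm P z) := by
  have hc := continuous_quadForm P
  have hon : ∀ a b, IntegrableOn h (Set.Icc a b) := fun a b => by
    have := IntegrableOn.mul_continuousOn (hint.integrableOn (s := Set.Icc a b))
      (g' := fun x => Real.exp (κ / 2 * quadForm P x)) (by fun_prop) isCompact_Icc
    refine this.congr_fun (fun x _ => ?_) measurableSet_Icc
    simp only
    rw [mul_assoc, ← Real.exp_add]; simp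
  obtain ⟨q, hq, hqb⟩ := exists_quadForm_le_dotProduct P
  -- Bound for the form at `x - z` when every coordinate of `x - z` is at most 3 in absolute value.
  set q0 := q * (9 * Fintype.card ι)
  set J := ∫ x, |h x * Real.exp (-(κ / 2 * quadForm P x))|
  have hJ : 0 ≤ J := integral_nonneg fun x => abs_nonneg _
  refine ⟨3 * (Real.exp (κ / 2 * ((1 + 1 / η) * q0)) * J), by positivity, fun z => ?_⟩
  refine (hh.abs_le_setIntegral hon z).trans ?_
  have hbox : ∀ x ∈ Set.Icc (z - 3) (z + 3),
      |h x| ≤ Real.exp (κ / 2 * ((1 + 1 / η) * q0)) * Real.exp (κ * (1 + η) / 2 * quadForm P z) *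
        |h x * Real.exp (-(κ / 2 * quadForm P x))| := by
    intro x hx
    have hv : quadForm P (x - z) ≤ q0 := by
      refine (hqb _).trans (mul_le_mul_of_nonneg_left ?_ hq.le)
      simp only [dotProduct]
      have : ∀ i ∈ Finset.univ, (x - z) i * (x - z) i ≤ (9 : ℝ) := fun i _ => by
        have h1 := hx.1 i
        have h2 := hx.2 i
        simp only [Pi.sub_apply, Pi.add_apply, Pi.ofNat_apply] at *
        nlinarith
      refine (Finset.sum_le_sum this).trans (le_of_eq ?_)
      simp [mul_comm]
    have hQ : quadForm P x ≤ (1 + η) * quadForm P z + (1 + 1 / η) * q0 := by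
      have := quadForm_add_le hP hη z (x - z)
      rw [add_sub_cancel] at this
      refine this.trans (add_le_add_right (mul_le_mul_of_nonneg_left hv (by positivity)) _)
    rw [abs_mul, Real.abs_exp, ← Real.exp_add, mul_comm |h x|, ← mul_assoc, ← Real.exp_add]
    refine le_mul_of_one_le_left (abs_nonneg _) (Real.one_le_exp ?_)
    have := mul_le_mul_of_nonneg_left hQ (by positivity : 0 ≤ κ / 2)
    linarith
  have h1 := setIntegral_mono_on (hon _ _).abs ((hint.abs.const_mul _).integrableOn)
    measurableSet_Icc hbox
  rw [integral_const_mul] at h1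
  have h2 : ∫ x in Set.Icc (z - 3) (z + 3), |h x * Real.exp (-(κ / 2 * quadForm P x))| ≤ J :=
    setIntegral_le_integral hint.abs (ae_of_all _ fun x => abs_nonneg _)
  have h3 := mul_le_mul_of_nonneg_left h2 (by positivity :
    0 ≤ Real.exp (κ / 2 * ((1 + 1 / η) * q0)) * Real.exp (κ * (1 + η) / 2 * quadForm P z))
  linarith

/-- A directionally convex function with Gaussian-type integrability for the covariance `B` has
quadratic-exponential growth controlled by every covariance matrix dominated by `B`. -/
lemma DirConvex.exists_abs_le_exp_of_le (hh : DirConvex h) {B C : Matrix ι ι ℝ} (hB : B.PosDef)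
    (hC : C.PosDef) (hCB : ∀ i j, C i j ≤ B i j) {κ : ℝ} (hκ : 0 ≤ κ) (hκ1 : κ < 1)
    (hint : Integrable fun x => h x * Real.exp (-(κ / 2 * quadForm B⁻¹ x))) :
    ∃ K κ' : ℝ, κ' < 1 ∧ ∀ z, |h z| ≤ K * Real.exp (κ' / 2 * quadForm C⁻¹ z) := by
  set η := (1 - κ) / 8 with hη
  have hη0 : 0 < η := by rw [hη]; linarith
  have hB0 := hB.inv.posSemidef
  obtain ⟨K, hK, hb⟩ := hh.exists_abs_le_exp hB0 hκ hη0 hint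
  obtain ⟨c, hc, hcb⟩ := exists_quadForm_inv_le (B := B) hC
  set c1 := 2 + 2 * c
  -- Overshooting `y` by a fraction `1 / n` of the displacement then costs at most another `η` in
  -- the quadratic form.
  obtain ⟨n, hn⟩ := exists_nat_gt ((1 + 1 / η) * c1 / η)
  have hn0 : 0 < (n : ℝ) := lt_of_le_of_lt (by positivity) hn
  have hn1 : 1 ≤ n := by exact_mod_cast hn0
  have hnn : (1 + 1 / η) * (c1 / n ^ 2) ≤ η := by
    rw [div_lt_iff₀ hη0] at hn
    rw [← mul_div_assoc, div_le_iff₀ (by positivity)]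
    have : (1 : ℝ) ≤ n := by exact_mod_cast hn1
    nlinarith [mul_le_mul_of_nonneg_right this hn0.le]
  have hQC : ∀ z, 0 ≤ quadForm C⁻¹ z := quadForm_nonneg hC.inv.posSemidef
  -- One factor is lost in the pointwise bound, the other in the overshoot; `η = (1 - κ) / 8` keeps
  -- the product below 1.
  set κ' := κ * (1 + η) * (1 + 2 * η)
  have hκ' : κ' < 1 := by
    have : κ = 1 - 8 * η := by rw [hη]; ring
    have h8 : η ≤ 1 / 8 := by rw [hη]; linarith
    simp only [κ', this]
    nlinarith [sq_nonneg η, mul_pos hη0 hη0, mul_pos (mul_pos hη0 hη0) hη0]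
  have hgood : ∀ z x, quadForm B⁻¹ x ≤ (1 + 2 * η) * quadForm C⁻¹ z →
      |h x| ≤ K * Real.exp (κ' / 2 * quadForm C⁻¹ z) := by
    intro z x hx
    refine (hb x).trans (mul_le_mul_of_nonneg_left (Real.exp_le_exp.2 ?_) hK)
    have := mul_le_mul_of_nonneg_left hx (by positivity : 0 ≤ κ * (1 + η) / 2)
    simp only [κ']
    linarith
  refine ⟨(4 * n + 3) * K, κ', hκ', fun z => ?_⟩
  -- The point `z` itself may be badly placed for `B⁻¹`, but it is sandwiched as `-y' ≤ z ≤ y`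
  -- between points where the bound for `B` is good.
  obtain ⟨y, hy, hyQ⟩ := exists_ge_quadForm_inv_le hB hC hCB z
  obtain ⟨y', hy', hyQ'⟩ := exists_ge_quadForm_inv_le hB hC hCB (-z)
  rw [quadForm_neg] at hyQ'
  have hdiff : ∀ x, quadForm B⁻¹ x ≤ quadForm C⁻¹ z → ∀ s, s = x + z ∨ s = x - z →
      quadForm B⁻¹ s ≤ c1 * quadForm C⁻¹ z := by
    intro x hx s hs
    have e : quadForm B⁻¹ s ≤ 2 * quadForm B⁻¹ x + 2 * quadForm B⁻¹ z := by
      rcases hs with rfl | rfl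
      · have := quadForm_add_le hB0 one_pos x z
        norm_num at this; linarith
      · have := quadForm_add_le hB0 one_pos x (-z)
        rw [quadForm_neg, ← sub_eq_add_neg] at this
        norm_num at this; linarith
    have := hcb z
    simp only [c1]; linarith
  have hover : ∀ s, quadForm B⁻¹ s ≤ c1 * quadForm C⁻¹ z →
      |h (y + (1 / n : ℝ) • s)| ≤ K * Real.exp (κ' / 2 * quadForm C⁻¹ z) := by
    intro s hs
    refine hgood z _ ((quadForm_add_le hB0 hη0 _ _).trans ?_)
    rw [quadForm_smul]
    have h1 : (1 / n : ℝ) ^ 2 * quadForm B⁻¹ s ≤ (c1 / n ^ 2) * quadForm C⁻¹ z := by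
      rw [div_pow, one_pow, div_mul_eq_mul_div, one_mul, div_mul_eq_mul_div]
      exact div_le_div_of_nonneg_right hs (by positivity)
    have h2 := mul_le_mul_of_nonneg_left h1 (by positivity : 0 ≤ 1 + 1 / η)
    have h3 := mul_le_mul_of_nonneg_right hnn (hQC z)
    have h4 := mul_le_mul_of_nonneg_left hyQ (by positivity : 0 ≤ 1 + η)
    linarith
  have hle : ∀ q, q ≤ quadForm C⁻¹ z → q ≤ (1 + 2 * η) * quadForm C⁻¹ z := fun q hq =>
    hq.trans (le_mul_of_one_le_left (hQC z) (by linarith))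
  have g1 := hgood z y (hle _ hyQ)
  have g2 := hgood z (-y') (hle _ (by rwa [quadForm_neg]))
  have g3 := hover (y - z) (hdiff y hyQ _ (Or.inr rfl))
  have g4 := hover (y' + z) (hdiff y' hyQ' _ (Or.inl rfl))
  set E := K * Real.exp (κ' / 2 * quadForm C⁻¹ z)
  have hs : 0 ≤ y - z := sub_nonneg.2 hy
  have hr : 0 ≤ y' + z := by simpa using add_le_add_left hy' z
  -- Lower bounds for `h` at `z` and at `y - (y' + z)`, by extrapolating from each through `y` to
  -- slightly beyond it.
  have low1 := hh.extrapolate_div z hs hn1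
  rw [add_sub_cancel] at low1
  have low2 := hh.extrapolate_div (y - (y' + z)) hr hn1
  rw [sub_add_cancel] at low2
  -- The rectangle with extreme corners `-y'` and `y` has `z` and `y - (y' + z)` as its other
  -- corners, so the second lower bound becomes an upper bound at `z`.
  have up := hh (-y') (y - z) (y' + z) hs hr
  rw [show -y' + (y - z) = y - (y' + z) by abel, show -y' + (y' + z) = z by abel,
    sub_add_cancel] at up
  rw [abs_le] at g1 g2 g3 g4
  have m1 : (n + 1) * (-E) ≤ (n + 1) * h y := mul_le_mul_of_nonneg_left g1.1 (by positivity)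
  have m3 : n * h (y + (1 / n : ℝ) • (y - z)) ≤ n * E := mul_le_mul_of_nonneg_left g3.2 hn0.le
  have m4 : n * h (y + (1 / n : ℝ) • (y' + z)) ≤ n * E := mul_le_mul_of_nonneg_left g4.2 hn0.le
  have hE : 0 ≤ n * E := by positivity
  have hE0 : 0 ≤ E := by positivity
  have e : (4 * n + 3) * K * Real.exp (κ' / 2 * quadForm C⁻¹ z) = 4 * (n * E) + 3 * E := by
    simp only [E]; ring
  rw [e, abs_le]
  constructor <;> linarith

/-- In standard normal coordinates the integrand factorises, and `κ < 1` leaves a Gaussian tail in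
each factor. -/
lemma integrable_exp_mul_quadForm_inv {C : Matrix ι ι ℝ} (hC : C.PosDef) {κ : ℝ} (hκ : κ < 1) :
    Integrable (fun z => Real.exp (κ / 2 * quadForm C⁻¹ z)) (normalLaw C) := by
  have hc := continuous_quadForm C⁻¹
  rw [normalLaw, integrable_map_measure (by fun_prop) (measurable_mulVec _).aemeasurable]
  have e : ((fun z => Real.exp (κ / 2 * quadForm C⁻¹ z)) ∘ fun g => symmSqrt C *ᵥ g) =
      fun g : ι → ℝ => ∏ i, Real.exp (κ / 2 * g i ^ 2) := by
    ext g
    simp only [Function.comp_apply]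
    rw [show quadForm C⁻¹ (symmSqrt C *ᵥ g) = g ⬝ᵥ g from dotProduct_inv_mulVec_symmSqrt hC g,
      ← Real.exp_sum, dotProduct, Finset.mul_sum]
    simp [sq]
  rw [e, stdNormal]
  refine Integrable.fintype_prod (f := fun _ x => Real.exp (κ / 2 * x ^ 2)) fun i => ?_
  rw [gaussianReal_of_var_ne_zero _ one_ne_zero, integrable_withDensity_iff_integrable_smul'
    (measurable_gaussianPDF _ _) (ae_of_all _ fun x => by simp [gaussianPDF])]
  have := (integrable_exp_neg_mul_sq (b := (1 - κ) / 2) (by linarith)).const_mul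
    (√(2 * Real.pi))⁻¹
  refine this.congr (ae_of_all _ fun x => ?_)
  simp only [gaussianPDF]
  rw [ENNReal.toReal_ofReal (gaussianPDFReal_nonneg _ _ _)]
  simp only [gaussianPDFReal, smul_eq_mul, NNReal.coe_one, mul_one, sub_zero, mul_assoc,
    ← Real.exp_add]
  congr 2
  ring

lemma DirConvex.integrable_normalLaw_of_le (hh : DirConvex h) (hm : Measurable h)
    {B C : Matrix ι ι ℝ} (hB : B.PosDef) (hC : C.PosDef) (hCB : ∀ i j, C i j ≤ B i j)
    {κ : ℝ} (hκ : 0 ≤ κ) (hκ1 : κ < 1)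
    (hint : Integrable fun x => h x * Real.exp (-(κ / 2 * quadForm B⁻¹ x))) :
    Integrable h (normalLaw C) := by
  obtain ⟨K, κ', hκ', hb⟩ := hh.exists_abs_le_exp_of_le hB hC hCB hκ hκ1 hint
  exact ((integrable_exp_mul_quadForm_inv hC hκ').const_mul K).mono' hm.aestronglyMeasurable
    (ae_of_all _ hb)

end Growth

/-! ### Raising a single off-diagonal covariance -/

section Interpolation

variable {ι : Type*} [Fintype ι] [DecidableEq ι] {h : (ι → ℝ) → ℝ}

lemma quadForm_add_matrix (P R : Matrix ι ι ℝ) (x : ι → ℝ) :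
    quadForm (P + R) x = quadForm P x + quadForm R x := by
  simp [quadForm, Matrix.add_mulVec, dotProduct_add]

lemma quadForm_smul_matrix (t : ℝ) (P : Matrix ι ι ℝ) (x : ι → ℝ) :
    quadForm (t • P) x = t * quadForm P x := by
  simp [quadForm, Matrix.smul_mulVec]

lemma quadForm_single (a b : ι) (x : ι → ℝ) : quadForm (Matrix.single a b 1) x = x a * x b := by
  simp [quadForm, Matrix.single_mulVec, Function.update_apply, dotProduct]

/-- The matrix with ones at the positions `(a, b)` and `(b, a)` (a two at `(a, a)` if `a = b`). -/
def symmUnit (a b : ι) : Matrix ι ι ℝ := Matrix.single a b 1 + Matrix.single b a 1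

lemma quadForm_symmUnit (a b : ι) (x : ι → ℝ) : quadForm (symmUnit a b) x = 2 * (x a * x b) := by
  rw [symmUnit, quadForm_add_matrix, quadForm_single, quadForm_single]; ring

lemma isHermitian_symmUnit (a b : ι) : (symmUnit a b).IsHermitian := by
  rw [Matrix.IsHermitian, symmUnit, Matrix.conjTranspose_add]
  simp [add_comm]

lemma posSemidef_of_quadForm_nonneg {P : Matrix ι ι ℝ} (hP : P.IsHermitian)
    (hq : ∀ x, 0 ≤ quadForm P x) : P.PosSemidef :=
  Matrix.PosSemidef.of_dotProduct_mulVec_nonneg hP fun x => by simpa [quadForm] using hq x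

lemma dotProduct_self_pos {x : ι → ℝ} (hx : x ≠ 0) : 0 < x ⬝ᵥ x := by
  have := (Matrix.dotProduct_star_self_pos_iff (v := x)).2 hx
  simpa using this

lemma posDef_of_le_quadForm {P : Matrix ι ι ℝ} (hP : P.IsHermitian) {c : ℝ} (hc : 0 < c)
    (hq : ∀ x, c * (x ⬝ᵥ x) ≤ quadForm P x) : P.PosDef :=
  Matrix.PosDef.of_dotProduct_mulVec_pos hP fun x hx => by
    have := (mul_pos hc (dotProduct_self_pos hx)).trans_le (hq x)
    simpa [quadForm] using this

lemma add_sq_le_dotProduct {a b : ι} (hab : a ≠ b) (x : ι → ℝ) :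
    x a * x a + x b * x b ≤ x ⬝ᵥ x := by
  rw [dotProduct, ← Finset.sum_pair (f := fun i => x i * x i) hab]
  exact Finset.sum_le_univ_sum_of_nonneg fun i => mul_self_nonneg _

lemma normalLaw_prod_map_eq {κ : Type*} [Fintype κ] [DecidableEq κ] {C D : Matrix ι ι ℝ}
    (hC : C.PosSemidef) (hD : D.PosSemidef) (T : (ι → ℝ) × (κ → ℝ) →L[ℝ] (ι → ℝ))
    (hT : ∀ φ : StrongDual ℝ (ι → ℝ), quadForm D (fun i => φ (T (Pi.single i 1, 0))) +
      ∑ k, φ (T (0, Pi.single k 1)) ^ 2 = quadForm C fun i => φ (Pi.single i 1)) :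
    ((normalLaw D).prod (stdNormal κ)).map T = normalLaw C := by
  have : IsProbabilityMeasure (((normalLaw D).prod (stdNormal κ)).map T) :=
    Measure.isProbabilityMeasure_map T.continuous.measurable.aemeasurable
  refine Measure.ext_of_charFunDual ?_
  ext φ
  rw [charFunDual_map, charFunDual_prod, charFunDual_normalLaw hD, charFunDual_stdNormal,
    charFunDual_normalLaw hC, ← Complex.exp_add, ← Complex.ofReal_add]
  congr 2
  have := hT φ
  simp only [quadForm] at this
  rw [← this]
  simp only [ContinuousLinearMap.comp_apply, ContinuousLinearMap.inl_apply,
    ContinuousLinearMap.inr_apply]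
  ring

/-- Independent noise of variance `c` is split off in coordinates `a` and `b`. Driving both
coordinates by the same normal variable gives correlation `ρ` between the noises; driving them by
independent copies gives correlation 0. Exchanging two copies compares the two cases pointwise. -/
lemma integral_normalLaw_le_add_symmUnit (hh : DirConvex h) {C : Matrix ι ι ℝ}
    {a b : ι} {c ρ : ℝ} (hc : 0 ≤ c) (hρ : 0 ≤ ρ) (hρ1 : ρ ≤ 1)
    (hD : (C - c • (Matrix.single a a 1 + Matrix.single b b 1)).PosSemidef)
    (hC : C.PosSemidef) (hC' : (C + (ρ * c) • symmUnit a b).PosSemidef)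
    (hint : Integrable h (normalLaw C))
    (hint' : Integrable h (normalLaw (C + (ρ * c) • symmUnit a b))) :
    ∫ z, h z ∂(normalLaw C) ≤ ∫ z, h z ∂(normalLaw (C + (ρ * c) • symmUnit a b)) := by
  set D := C - c • (Matrix.single a a 1 + Matrix.single b b 1) with hDdef
  set σ := √(1 - ρ ^ 2)
  have hσ : σ ^ 2 = 1 - ρ ^ 2 := Real.sq_sqrt (by nlinarith)
  have hsc : √c ^ 2 = c := Real.sq_sqrt hc
  -- Coordinate `a` is driven by variable `i`, coordinate `b` by variable `j` with weight `ρ`;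
  -- variable 2 restores the variance in coordinate `b`.
  let T : Fin 3 → Fin 3 → (ι → ℝ) × (Fin 3 → ℝ) →L[ℝ] (ι → ℝ) := fun i j =>
    ContinuousLinearMap.fst ℝ _ _ +
      (√c • (ContinuousLinearMap.proj (R := ℝ) (φ := fun _ : Fin 3 => ℝ) i).comp
        (ContinuousLinearMap.snd ℝ _ _)).smulRight (Pi.single a 1) +
      (√c • (ρ • ContinuousLinearMap.proj (R := ℝ) (φ := fun _ : Fin 3 => ℝ) j +
        σ • ContinuousLinearMap.proj (R := ℝ) (φ := fun _ : Fin 3 => ℝ) 2).comp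
        (ContinuousLinearMap.snd ℝ _ _)).smulRight (Pi.single b 1)
  have hTa : ∀ i j p, T i j p = p.1 + (√c * p.2 i) • Pi.single a 1 +
      (√c * (ρ * p.2 j + σ * p.2 2)) • Pi.single b 1 := by
    intro i j p; simp [T]; ring
  have hCD : ∀ x, quadForm C x = quadForm D x + c * (x a * x a + x b * x b) := fun x => by
    have e : C = D + c • (Matrix.single a a 1 + Matrix.single b b 1) := by
      rw [hDdef, sub_add_cancel]
    conv_lhs => rw [e]
    rw [quadForm_add_matrix, quadForm_smul_matrix, quadForm_add_matrix, quadForm_single,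
      quadForm_single]
  have hdiag : ∀ i, i = 0 ∨ i = 1 →
      ((normalLaw D).prod (stdNormal (Fin 3))).map (T i i) =
        normalLaw (C + (ρ * c) • symmUnit a b) := by
    intro i hi
    refine normalLaw_prod_map_eq hC' hD _ fun φ => ?_
    rw [quadForm_add_matrix, quadForm_smul_matrix, quadForm_symmUnit, hCD]
    rcases hi with rfl | rfl <;>
    · simp [hTa, Fin.sum_univ_three, Pi.single_apply]
      linear_combination (φ (Pi.single a 1) ^ 2 + 2 * ρ * φ (Pi.single a 1) * φ (Pi.single b 1) +
        (ρ ^ 2 + σ ^ 2) * φ (Pi.single b 1) ^ 2) * hsc + c * φ (Pi.single b 1) ^ 2 * hσ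
  have hcross : ∀ i j, (i = 0 ∧ j = 1) ∨ (i = 1 ∧ j = 0) →
      ((normalLaw D).prod (stdNormal (Fin 3))).map (T i j) = normalLaw C := by
    intro i j hij
    refine normalLaw_prod_map_eq hC hD _ fun φ => ?_
    rw [hCD]
    rcases hij with ⟨rfl, rfl⟩ | ⟨rfl, rfl⟩ <;>
    · simp [hTa, Fin.sum_univ_three, Pi.single_apply]
      linear_combination (φ (Pi.single a 1) ^ 2 + (ρ ^ 2 + σ ^ 2) * φ (Pi.single b 1) ^ 2) * hsc +
        c * φ (Pi.single b 1) ^ 2 * hσ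
  -- The four points are the corners of a parallelogram with nonnegative sides along `a` and `b`,
  -- since `ρ ≥ 0`.
  have hpt' : ∀ p : (ι → ℝ) × (Fin 3 → ℝ), ∀ i j : Fin 3, p.2 i ≤ p.2 j →
      h (T j i p) + h (T i j p) ≤ h (T i i p) + h (T j j p) := by
    intro p i j hle
    have hv : (0 : ι → ℝ) ≤ (√c * (p.2 j - p.2 i)) • Pi.single a 1 :=
      smul_nonneg (mul_nonneg (Real.sqrt_nonneg _) (sub_nonneg.2 hle))
        (Pi.single_nonneg.2 zero_le_one)
    have hw : (0 : ι → ℝ) ≤ (√c * (ρ * (p.2 j - p.2 i))) • Pi.single b 1 :=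
      smul_nonneg (mul_nonneg (Real.sqrt_nonneg _) (mul_nonneg hρ (sub_nonneg.2 hle)))
        (Pi.single_nonneg.2 zero_le_one)
    have := hh (T i i p) _ _ hv hw
    convert this using 3 <;> simp only [hTa] <;> module
  have hpt : ∀ p, h (T 1 0 p) + h (T 0 1 p) ≤ h (T 0 0 p) + h (T 1 1 p) := fun p => by
    rcases le_total (p.2 0) (p.2 1) with h1 | h1
    · exact hpt' p 0 1 h1
    · have := hpt' p 1 0 h1
      linarith
  have hTm : ∀ i j, AEMeasurable (T i j) ((normalLaw D).prod (stdNormal (Fin 3))) := fun i j =>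
    (T i j).continuous.measurable.aemeasurable
  have main : ∀ i j (M : Matrix ι ι ℝ), Integrable h (normalLaw M) →
      ((normalLaw D).prod (stdNormal (Fin 3))).map (T i j) = normalLaw M →
      Integrable (fun p => h (T i j p)) ((normalLaw D).prod (stdNormal (Fin 3))) ∧
      ∫ p, h (T i j p) ∂((normalLaw D).prod (stdNormal (Fin 3))) = ∫ z, h z ∂(normalLaw M) := by
    intro i j M hM he
    rw [← he] at hM ⊢
    exact ⟨hM.comp_aemeasurable (hTm i j), (integral_map (hTm i j) hM.aestronglyMeasurable).symm⟩
  obtain ⟨i00, e00⟩ := main 0 0 _ hint' (hdiag 0 (Or.inl rfl))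
  obtain ⟨i11, e11⟩ := main 1 1 _ hint' (hdiag 1 (Or.inr rfl))
  obtain ⟨i01, e01⟩ := main 0 1 _ hint (hcross 0 1 (Or.inl ⟨rfl, rfl⟩))
  obtain ⟨i10, e10⟩ := main 1 0 _ hint (hcross 1 0 (Or.inr ⟨rfl, rfl⟩))
  have := integral_mono (i10.add i01) (i00.add i11) hpt
  simp only [Pi.add_apply] at this
  rw [integral_add i10 i01, integral_add i00 i11, e00, e11, e01, e10] at this
  linarith

end Interpolation

/-! ### From single entries to whole covariance matrices -/

section Path

variable {ι : Type*} [Fintype ι] [DecidableEq ι] {h : (ι → ℝ) → ℝ}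

lemma exists_le_quadForm {A : Matrix ι ι ℝ} (hA : A.PosDef) :
    ∃ c, 0 < c ∧ ∀ x, c * (x ⬝ᵥ x) ≤ quadForm A x := by
  obtain ⟨K, hK, h⟩ := exists_dotProduct_le_quadForm_inv hA.inv
  rw [Matrix.nonsing_inv_nonsing_inv _ hA.det_pos.ne'.isUnit] at h
  refine ⟨K⁻¹, by positivity, fun x => ?_⟩
  rw [inv_mul_le_iff₀ hK]
  exact h x

lemma dotProduct_self_nonneg (x : ι → ℝ) : 0 ≤ x ⬝ᵥ x := by
  simpa [dotProduct] using Finset.sum_nonneg fun i _ => mul_self_nonneg (x i)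

/-- The part of `D` carried by the (ordered) pairs of indices in `s`, symmetrised. -/
noncomputable def maskedPart (D : Matrix ι ι ℝ) (s : Finset (ι × ι)) : Matrix ι ι ℝ :=
  ∑ p ∈ s, (D p.1 p.2 / 2) • symmUnit p.1 p.2

lemma maskedPart_apply_le {D : Matrix ι ι ℝ} (hD : ∀ i j, 0 ≤ D i j) (s : Finset (ι × ι))
    (i j : ι) : maskedPart D s i j ≤ maskedPart D Finset.univ i j := by
  simp only [maskedPart, Matrix.sum_apply]
  refine Finset.sum_le_univ_sum_of_nonneg fun p => ?_
  simp only [Matrix.smul_apply, symmUnit, Matrix.add_apply, smul_eq_mul, Matrix.single_apply]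
  have := hD p.1 p.2
  split_ifs <;> linarith

lemma maskedPart_univ {D : Matrix ι ι ℝ} (hD : D.IsHermitian) : maskedPart D Finset.univ = D := by
  have h1 : D = ∑ i, ∑ j, Matrix.single i j (D i j) := Matrix.matrix_eq_sum_single D
  have h2 : D = ∑ i, ∑ j, Matrix.single j i (D i j) := by
    have : Dᵀ = D := hD
    conv_lhs => rw [← this, Matrix.matrix_eq_sum_single D]
    simp [Matrix.transpose_sum]
  have h3 : maskedPart D Finset.univ = (1 / 2 : ℝ) •
      (∑ i, ∑ j, Matrix.single i j (D i j) + ∑ i, ∑ j, Matrix.single j i (D i j)) := by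
    rw [maskedPart, ← Finset.univ_product_univ, Finset.sum_product, ← Finset.sum_add_distrib,
      Finset.smul_sum]
    refine Finset.sum_congr rfl fun i _ => ?_
    rw [← Finset.sum_add_distrib, Finset.smul_sum]
    refine Finset.sum_congr rfl fun j _ => ?_
    simp only [symmUnit, smul_add, Matrix.smul_single, smul_eq_mul, mul_one]
    congr 2 <;> ring
  rw [h3, ← h1, ← h2]
  module

lemma isHermitian_maskedPart (D : Matrix ι ι ℝ) (s : Finset (ι × ι)) :
    (maskedPart D s).IsHermitian := by
  induction s using Finset.induction_on with
  | empty => simp [maskedPart, Matrix.IsHermitian]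
  | insert p s hp ih =>
    rw [maskedPart, Finset.sum_insert hp]
    refine Matrix.IsHermitian.add ?_ ih
    rw [Matrix.IsHermitian, Matrix.conjTranspose_smul, (isHermitian_symmUnit _ _).eq]
    simp

lemma neg_le_quadForm_maskedPart {D : Matrix ι ι ℝ} (hD : ∀ i j, 0 ≤ D i j)
    (s : Finset (ι × ι)) (x : ι → ℝ) :
    -((∑ p : ι × ι, D p.1 p.2) * (x ⬝ᵥ x)) ≤ quadForm (maskedPart D s) x := by
  have hx : ∀ i, x i * x i ≤ x ⬝ᵥ x := fun i =>
    Finset.single_le_sum (f := fun i => x i * x i) (fun j _ => mul_self_nonneg _)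
      (Finset.mem_univ i)
  have e : quadForm (maskedPart D s) x = ∑ p ∈ s, D p.1 p.2 * (x p.1 * x p.2) := by
    induction s using Finset.induction_on with
    | empty => simp [maskedPart, quadForm]
    | insert p s hp ih =>
      rw [maskedPart, Finset.sum_insert hp, Finset.sum_insert hp, quadForm_add_matrix,
        quadForm_smul_matrix, quadForm_symmUnit, ← ih, maskedPart]
      ring
  have h0 := dotProduct_self_nonneg x
  have h1 : (∑ p ∈ s, D p.1 p.2) * (x ⬝ᵥ x) ≤ (∑ p : ι × ι, D p.1 p.2) * (x ⬝ᵥ x) :=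
    mul_le_mul_of_nonneg_right (Finset.sum_le_univ_sum_of_nonneg fun p => hD _ _) h0
  have h2 : -((∑ p ∈ s, D p.1 p.2) * (x ⬝ᵥ x)) ≤ ∑ p ∈ s, D p.1 p.2 * (x p.1 * x p.2) := by
    rw [Finset.sum_mul, ← Finset.sum_neg_distrib]
    refine Finset.sum_le_sum fun p _ => ?_
    have h3 : -(x ⬝ᵥ x) ≤ x p.1 * x p.2 := by
      nlinarith [hx p.1, hx p.2, mul_self_nonneg (x p.1 + x p.2)]
    have := mul_le_mul_of_nonneg_left h3 (hD p.1 p.2)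
    linarith
  rw [e]
  linarith

/-- The entries of `τ D` are added pair by pair. Partial sums may destroy positivity in general, but
a step this short costs at most half of the lower bound `2c`, leaving variance `c` to split off for
every coupling. -/
lemma integral_normalLaw_le_of_small_step (hh : DirConvex h) {A D : Matrix ι ι ℝ}
    (hA : A.IsHermitian) (hD : ∀ i j, 0 ≤ D i j) (hdiag : ∀ i, D i i = 0)
    (hDh : D.IsHermitian) {c τ : ℝ} (hc : 0 < c) (hτ : 0 ≤ τ)
    (hτc : τ * ∑ p : ι × ι, D p.1 p.2 ≤ c) (hAc : ∀ x, 2 * c * (x ⬝ᵥ x) ≤ quadForm A x)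
    (hint : ∀ C : Matrix ι ι ℝ, C.PosDef → (∀ i j, C i j ≤ (A + τ • D) i j) →
      Integrable h (normalLaw C)) :
    ∫ z, h z ∂(normalLaw A) ≤ ∫ z, h z ∂(normalLaw (A + τ • D)) := by
  have hq : ∀ s x, c * (x ⬝ᵥ x) ≤ quadForm (A + τ • maskedPart D s) x := fun s x => by
    rw [quadForm_add_matrix, quadForm_smul_matrix]
    have h1 := mul_le_mul_of_nonneg_left (neg_le_quadForm_maskedPart hD s x) hτ
    have h2 := mul_le_mul_of_nonneg_right hτc (dotProduct_self_nonneg x)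
    have h3 := hAc x
    linarith
  have hH : ∀ s, (A + τ • maskedPart D s).IsHermitian := fun s => by
    refine hA.add ?_
    rw [Matrix.IsHermitian, Matrix.conjTranspose_smul, (isHermitian_maskedPart D s).eq]
    simp
  have hPD : ∀ s, (A + τ • maskedPart D s).PosDef := fun s =>
    posDef_of_le_quadForm (hH s) hc (hq s)
  have hI : ∀ s, Integrable h (normalLaw (A + τ • maskedPart D s)) := fun s => by
    refine hint _ (hPD s) fun i j => ?_
    simp only [Matrix.add_apply, Matrix.smul_apply, smul_eq_mul]
    have := maskedPart_apply_le hD s i j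
    rw [maskedPart_univ hDh] at this
    linarith [mul_le_mul_of_nonneg_left this hτ]
  have key : ∀ s, ∫ z, h z ∂(normalLaw A) ≤ ∫ z, h z ∂(normalLaw (A + τ • maskedPart D s)) := by
    intro s
    induction s using Finset.induction_on with
    | empty => simp [maskedPart]
    | insert p s hp ih =>
      refine ih.trans ?_
      have hins : A + τ • maskedPart D (insert p s) =
          A + τ • maskedPart D s + (τ * D p.1 p.2 / (2 * c) * c) • symmUnit p.1 p.2 := by
        rw [maskedPart, Finset.sum_insert hp, smul_add, smul_smul, maskedPart, add_assoc,
          add_comm (τ • _)]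
        congr 3
        field_simp
      rcases eq_or_ne p.1 p.2 with hab | hab
      · have : D p.1 p.2 = 0 := by rw [← hab]; exact hdiag _
        rw [hins, this]; simp
      · have hIn := hI (insert p s)
        have hPn := (hPD (insert p s)).posSemidef
        rw [hins] at hIn hPn ⊢
        refine integral_normalLaw_le_add_symmUnit hh hc.le (by have := hD p.1 p.2; positivity) ?_ ?_
          (hPD s).posSemidef hPn (hI s) hIn
        · rw [div_le_one (by positivity)]
          have h1 : D p.1 p.2 ≤ ∑ p : ι × ι, D p.1 p.2 :=
            Finset.single_le_sum (f := fun p : ι × ι => D p.1 p.2) (fun p _ => hD _ _)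
              (Finset.mem_univ p)
          linarith [mul_le_mul_of_nonneg_left h1 hτ]
        · refine posSemidef_of_quadForm_nonneg ((hH s).sub ?_) fun x => ?_
          · rw [Matrix.IsHermitian, Matrix.conjTranspose_smul]
            simp
          · have h1 := hq s x
            have h2 := mul_le_mul_of_nonneg_left (add_sq_le_dotProduct hab x) hc.le
            rw [sub_eq_add_neg, quadForm_add_matrix, ← neg_smul, quadForm_smul_matrix,
              quadForm_add_matrix (Matrix.single _ _ _), quadForm_single, quadForm_single]
            linarith
  have := key Finset.univ
  rwa [maskedPart_univ hDh] at this

/-- Monotonicity of Gaussian expectations of directionally convex functions in the off-diagonal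
covariances, for functions integrable with respect to all dominated Gaussian laws. -/
lemma integral_normalLaw_mono_of_forall_integrable (hh : DirConvex h) {A B : Matrix ι ι ℝ}
    (hA : A.PosDef) (hB : B.PosDef) (hAB : ∀ i j, A i j ≤ B i j) (hdiag : ∀ i, A i i = B i i)
    (hint : ∀ C : Matrix ι ι ℝ, C.PosDef → (∀ i j, C i j ≤ B i j) → Integrable h (normalLaw C)) :
    ∫ z, h z ∂(normalLaw A) ≤ ∫ z, h z ∂(normalLaw B) := by
  obtain ⟨a, ha, haq⟩ := exists_le_quadForm hA
  obtain ⟨b, hb, hbq⟩ := exists_le_quadForm hB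
  -- Every matrix on the segment from `A` to `B` is a convex combination, so its form is bounded
  -- below by `2c`; one step length then works for the whole path.
  set c := min a b / 2
  have hc : 0 < c := half_pos (lt_min ha hb)
  set D := B - A with hDdef
  have hD : ∀ i j, 0 ≤ D i j := fun i j => sub_nonneg.2 (hAB i j)
  have hDd : ∀ i, D i i = 0 := fun i => sub_eq_zero.2 (hdiag i).symm
  have hDh : D.IsHermitian := hB.isHermitian.sub hA.isHermitian
  have hBD : B = A + D := by rw [hDdef, add_sub_cancel]
  set W := ∑ p : ι × ι, D p.1 p.2
  obtain ⟨N, hN⟩ := exists_nat_gt (W / c)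
  have hW : 0 ≤ W := Finset.sum_nonneg fun p _ => hD _ _
  have hN0 : (0 : ℝ) < N := lt_of_le_of_lt (by positivity) hN
  have key : ∀ k : ℕ, k ≤ N →
      ∫ z, h z ∂(normalLaw A) ≤ ∫ z, h z ∂(normalLaw (A + ((k : ℝ) / N) • D)) := by
    intro k
    induction k with
    | zero => simp
    | succ k ih =>
      intro hk
      refine (ih (by omega)).trans ?_
      have hkN : ((k : ℝ) + 1) / N ≤ 1 := by
        rw [div_le_one hN0]; exact_mod_cast hk
      have hstep : A + (((k + 1 : ℕ) : ℝ) / N) • D = A + ((k : ℝ) / N) • D + (1 / N : ℝ) • D := by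
        push_cast; rw [add_div]; module
      rw [hstep]
      refine integral_normalLaw_le_of_small_step hh (hA.isHermitian.add ?_) hD hDd hDh hc
        (by positivity) ?_ (fun x => ?_) (fun C hC hCle => hint C hC fun i j => ?_)
      · rw [Matrix.IsHermitian, Matrix.conjTranspose_smul, hDh.eq]; simp
      · rw [div_lt_iff₀ hc] at hN
        rw [one_div, inv_mul_le_iff₀ hN0]; exact hN.le
      · set t : ℝ := k / N
        have ht0 : 0 ≤ t := by positivity
        have ht1 : t ≤ 1 := le_trans (by simp only [t]; gcongr; linarith) hkN
        have e : A + t • D = (1 - t) • A + t • B := by rw [hBD]; module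
        rw [e, quadForm_add_matrix, quadForm_smul_matrix, quadForm_smul_matrix]
        have h0 := dotProduct_self_nonneg x
        have h1 : 2 * c * (x ⬝ᵥ x) ≤ quadForm A x := (mul_le_mul_of_nonneg_right
          (by simp only [c]; linarith [min_le_left a b]) h0).trans (haq x)
        have h2 : 2 * c * (x ⬝ᵥ x) ≤ quadForm B x := (mul_le_mul_of_nonneg_right
          (by simp only [c]; linarith [min_le_right a b]) h0).trans (hbq x)
        linarith [mul_le_mul_of_nonneg_left h1 (sub_nonneg.2 ht1), mul_le_mul_of_nonneg_left h2 ht0]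
      · refine (hCle i j).trans ?_
        rw [← hstep, hBD]
        simp only [Matrix.add_apply, Matrix.smul_apply, smul_eq_mul]
        push_cast
        linarith [mul_le_of_le_one_left (hD i j) hkN]
  have := key N le_rfl
  rwa [div_self hN0.ne', one_smul, ← hBD] at this

end Path

/-! ### Gaussian comparison under endpoint integrability -/

section GaussianOrder

open Filter Topology

variable {ι : Type*} [Fintype ι] [DecidableEq ι] {h : (ι → ℝ) → ℝ}

lemma normalPDF_zero (C : Matrix ι ι ℝ) (z : ι → ℝ) : normalPDF 0 C z =
    (√((2 * Real.pi) ^ Fintype.card ι * C.det))⁻¹ * Real.exp (-(1 / 2 * quadForm C⁻¹ z)) := by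
  rw [normalPDF, sub_zero, quadForm, neg_mul]

lemma normalPDF_nonneg (μ : ι → ℝ) (C : Matrix ι ι ℝ) (z : ι → ℝ) : 0 ≤ normalPDF μ C z := by
  unfold normalPDF; positivity

lemma measurable_normalPDF (C : Matrix ι ι ℝ) : Measurable (normalPDF 0 C) := by
  have := continuous_quadForm C⁻¹
  simp_rw [funext (normalPDF_zero C)]
  fun_prop

lemma normalPDF_const_pos {C : Matrix ι ι ℝ} (hC : C.PosDef) :
    0 < (√((2 * Real.pi) ^ Fintype.card ι * C.det))⁻¹ := by
  have := hC.det_pos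
  positivity

lemma integrable_normalLaw_iff {C : Matrix ι ι ℝ} (hC : C.PosDef) :
    Integrable h (normalLaw C) ↔
      Integrable fun x => h x * Real.exp (-(1 / 2 * quadForm C⁻¹ x)) := by
  rw [normalLaw_eq_withDensity hC, integrable_withDensity_iff_integrable_smul'
    (measurable_normalPDF C).ennreal_ofReal (ae_of_all _ fun x => ENNReal.ofReal_lt_top)]
  simp_rw [ENNReal.toReal_ofReal (normalPDF_nonneg _ _ _), normalPDF_zero, smul_eq_mul, mul_assoc]
  rw [integrable_const_mul_iff (normalPDF_const_pos hC).ne'.isUnit]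
  simp_rw [mul_comm]

lemma integral_normalLaw_eq {C : Matrix ι ι ℝ} (hC : C.PosDef) :
    ∫ x, h x ∂(normalLaw C) = (√((2 * Real.pi) ^ Fintype.card ι * C.det))⁻¹ *
      ∫ x, h x * Real.exp (-(1 / 2 * quadForm C⁻¹ x)) := by
  rw [normalLaw_eq_withDensity hC, integral_withDensity_eq_integral_toReal_smul
    (measurable_normalPDF C).ennreal_ofReal (ae_of_all _ fun x => ENNReal.ofReal_lt_top),
    ← integral_const_mul]
  simp_rw [ENNReal.toReal_ofReal (normalPDF_nonneg _ _ _), normalPDF_zero, smul_eq_mul]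
  congr 1 with x
  ring

lemma quadForm_inv_smul_smul (P : Matrix ι ι ℝ) {t : ℝ} (ht : t ≠ 0) (x : ι → ℝ) :
    quadForm P x = (t⁻¹) ^ 2 * quadForm P (t • x) := by
  rw [quadForm_smul, ← mul_assoc, ← mul_pow, inv_mul_cancel₀ ht, one_pow, one_mul]

/-- The dilation is moved from `h`, which need not be continuous, onto the density. For `t < 1` the
new Gaussian weight lies below the original one, so `|h|` times the original weight dominates. -/
lemma tendsto_integral_normalLaw_comp_smul {C : Matrix ι ι ℝ} (hC : C.PosDef) (hm : Measurable h)
    (hint : Integrable h (normalLaw C)) :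
    Tendsto (fun t : ℝ => ∫ x, h (t • x) ∂(normalLaw C)) (𝓝[<] 1)
      (𝓝 (∫ x, h x ∂(normalLaw C))) := by
  have hc := continuous_quadForm C⁻¹
  have hev : ∀ᶠ t : ℝ in 𝓝[<] 1, 0 < t ∧ t < 1 :=
    (Ioo_mem_nhdsLT (zero_lt_one (α := ℝ)))
  have ht1 : Tendsto (fun t : ℝ => t) (𝓝[<] 1) (𝓝 1) := nhdsWithin_le_nhds
  have hinv : Tendsto (fun t : ℝ => t⁻¹) (𝓝[<] 1) (𝓝 1) := by
    simpa using ht1.inv₀ one_ne_zero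
  have hlim : Tendsto (fun t : ℝ => ∫ x, h x * Real.exp (-(1 / 2 * ((t⁻¹) ^ 2 * quadForm C⁻¹ x))))
      (𝓝[<] 1) (𝓝 (∫ x, h x * Real.exp (-(1 / 2 * quadForm C⁻¹ x)))) := by
    refine tendsto_integral_filter_of_dominated_convergence
      (fun x => |h x * Real.exp (-(1 / 2 * quadForm C⁻¹ x))|) ?_ ?_
      ((integrable_normalLaw_iff hC).1 hint).abs ?_
    · exact Eventually.of_forall fun t => by
        have : Measurable fun x => h x * Real.exp (-(1 / 2 * ((t⁻¹) ^ 2 * quadForm C⁻¹ x))) := by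
          fun_prop
        exact this.aestronglyMeasurable
    · filter_upwards [hev] with t ht
      refine ae_of_all _ fun x => ?_
      rw [Real.norm_eq_abs, abs_mul, abs_mul, Real.abs_exp, Real.abs_exp]
      refine mul_le_mul_of_nonneg_left (Real.exp_le_exp.2 ?_) (abs_nonneg _)
      have h1 : 1 ≤ (t⁻¹) ^ 2 := one_le_pow₀ ((one_le_inv₀ ht.1).2 ht.2.le)
      have := le_mul_of_one_le_left (quadForm_nonneg hC.inv.posSemidef x) h1
      linarith
    · refine ae_of_all _ fun x => ?_
      have h2 : Tendsto (fun t : ℝ => h x * Real.exp (-(1 / 2 * ((t⁻¹) ^ 2 * quadForm C⁻¹ x))))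
          (𝓝[<] 1) (𝓝 (h x * Real.exp (-(1 / 2 * ((1 : ℝ) ^ 2 * quadForm C⁻¹ x))))) :=
        ((Real.continuous_exp.tendsto _).comp
          (((hinv.pow 2).mul_const _).const_mul _).neg).const_mul _
      simpa using h2
  have hfac : Tendsto (fun t : ℝ => |(t ^ Module.finrank ℝ (ι → ℝ))⁻¹|) (𝓝[<] 1) (𝓝 1) := by
    have := ((ht1.pow (Module.finrank ℝ (ι → ℝ))).inv₀ (by simp)).abs
    simpa using this
  rw [integral_normalLaw_eq hC]
  have := (hfac.mul hlim).const_mul (√((2 * Real.pi) ^ Fintype.card ι * C.det))⁻¹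
  rw [one_mul] at this
  refine this.congr' ?_
  filter_upwards [hev] with t ht
  rw [integral_normalLaw_eq hC (h := fun x => h (t • x))]
  congr 1
  rw [← smul_eq_mul, ← Measure.integral_comp_smul]
  congr 1 with x
  rw [← quadForm_inv_smul_smul _ ht.1.ne']

/-- Dilation by `t` weakens the weight needed for `B` to exponent `κ = t ^ 2 < 1`, the room required
by the growth bound. -/
lemma DirConvex.integrable_comp_smul_normalLaw (hh : DirConvex h) (hm : Measurable h)
    {B C : Matrix ι ι ℝ} (hB : B.PosDef) (hC : C.PosDef) (hCB : ∀ i j, C i j ≤ B i j)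
    (hint : Integrable h (normalLaw B)) {t : ℝ} (ht : 0 < t) (ht1 : t < 1) :
    Integrable (fun x => h (t • x)) (normalLaw C) := by
  refine (hh.comp_smul ht.le).integrable_normalLaw_of_le
    (hm.comp (measurable_const_smul t)) hB hC hCB (κ := t ^ 2) (by positivity)
    (pow_lt_one₀ ht.le ht1 two_ne_zero) ?_
  have := ((integrable_normalLaw_iff hB).1 hint).comp_smul ht.ne'
  refine this.congr (ae_of_all _ fun x => ?_)
  simp only [quadForm_smul]
  congr 3
  ring

/-- Gaussian laws with equal variances and entrywise ordered covariance matrices are ordered by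
directionally convex functions. -/
theorem integral_normalLaw_mono (hh : DirConvex h) (hm : Measurable h) {A B : Matrix ι ι ℝ}
    (hA : A.PosDef) (hB : B.PosDef) (hAB : ∀ i j, A i j ≤ B i j) (hdiag : ∀ i, A i i = B i i)
    (hiA : Integrable h (normalLaw A)) (hiB : Integrable h (normalLaw B)) :
    ∫ z, h z ∂(normalLaw A) ≤ ∫ z, h z ∂(normalLaw B) := by
  refine le_of_tendsto_of_tendsto (tendsto_integral_normalLaw_comp_smul hA hm hiA)
    (tendsto_integral_normalLaw_comp_smul hB hm hiB) ?_
  filter_upwards [Ioo_mem_nhdsLT (zero_lt_one (α := ℝ))] with t ht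
  exact integral_normalLaw_mono_of_forall_integrable (hh.comp_smul ht.1.le) hA hB hAB hdiag
    fun C hC hCB => hh.integrable_comp_smul_normalLaw hm hB hC hCB hiB ht.1 ht.2

end GaussianOrder

/-! ### Gaussian moments and the additive representation of the skew-normal law -/

section SkewLaw

variable {ι : Type*} [Fintype ι] [DecidableEq ι]

lemma normalLaw_map_dotProduct {C : Matrix ι ι ℝ} (hC : C.PosSemidef) (a : ι → ℝ) :
    (normalLaw C).map (fun z => a ⬝ᵥ z) = gaussianReal 0 (quadForm C a).toNNReal := by
  let φ : StrongDual ℝ (ι → ℝ) :=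
    ∑ i, a i • ContinuousLinearMap.proj (R := ℝ) (φ := fun _ : ι => ℝ) i
  have hφ : (fun z => a ⬝ᵥ z) = ⇑φ := by
    ext z; simp [φ, dotProduct]
  have hφi : (fun i => φ (Pi.single i 1)) = a := by
    ext i; rw [← congrFun hφ]; simp
  rw [hφ]
  have := Measure.isProbabilityMeasure_map (μ := normalLaw C) φ.continuous.measurable.aemeasurable
  refine Measure.ext_of_charFunDual ?_
  ext L
  rw [charFunDual_map, charFunDual_normalLaw hC, charFunDual_eq_charFun_map_one,
    gaussianReal_map_continuousLinearMap, charFun_gaussianReal]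
  have e : (fun i => (L.comp φ) (Pi.single i 1)) = L 1 • a := by
    rw [← hφi]
    ext i
    simp only [ContinuousLinearMap.comp_apply, Pi.smul_apply, smul_eq_mul]
    conv_lhs => rw [← mul_one (φ _), ← smul_eq_mul, map_smul, smul_eq_mul, mul_comm]
  rw [e]
  have h2 := quadForm_smul C (L 1) a
  simp only [quadForm] at h2
  rw [h2]
  have h0 := quadForm_nonneg hC a
  simp only [quadForm] at h0
  congr 1
  simp [quadForm, Real.coe_toNNReal _ h0, max_eq_left (sq_nonneg (L 1))]
  ring

lemma memLp_dotProduct_normalLaw {C : Matrix ι ι ℝ} (hC : C.PosSemidef) (a : ι → ℝ) :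
    MemLp (fun z => a ⬝ᵥ z) 2 (normalLaw C) := by
  have hm : Measurable fun z : ι → ℝ => a ⬝ᵥ z := by fun_prop
  have : MemLp id 2 ((normalLaw C).map fun z => a ⬝ᵥ z) := by
    rw [normalLaw_map_dotProduct hC]; exact memLp_id_gaussianReal 2
  exact (memLp_map_measure_iff this.aestronglyMeasurable hm.aemeasurable).1 this

lemma integral_dotProduct_normalLaw {C : Matrix ι ι ℝ} (hC : C.PosSemidef) (a : ι → ℝ) :
    ∫ z, a ⬝ᵥ z ∂(normalLaw C) = 0 := by
  have hm : Measurable fun z : ι → ℝ => a ⬝ᵥ z := by fun_prop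
  have := integral_map (μ := normalLaw C) hm.aemeasurable (f := fun x : ℝ => x)
    measurable_id.aestronglyMeasurable
  rw [← this, normalLaw_map_dotProduct hC, integral_id_gaussianReal]

lemma integral_dotProduct_sq_normalLaw {C : Matrix ι ι ℝ} (hC : C.PosSemidef) (a : ι → ℝ) :
    ∫ z, (a ⬝ᵥ z) ^ 2 ∂(normalLaw C) = quadForm C a := by
  have hm : Measurable fun z : ι → ℝ => a ⬝ᵥ z := by fun_prop
  have := integral_map (μ := normalLaw C) hm.aemeasurable (f := fun x : ℝ => x ^ 2)
    (by fun_prop)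
  rw [← this, normalLaw_map_dotProduct hC]
  have hv := variance_id_gaussianReal (μ := 0) (v := (quadForm C a).toNNReal)
  rw [variance_eq_integral aemeasurable_id] at hv
  simp only [id, integral_id_gaussianReal, sub_zero] at hv
  rw [hv, Real.coe_toNNReal _ (quadForm_nonneg hC a)]

lemma memLp_eval_normalLaw {C : Matrix ι ι ℝ} (hC : C.PosSemidef) (i : ι) :
    MemLp (fun z => z i) 2 (normalLaw C) := by
  simpa using memLp_dotProduct_normalLaw hC (Pi.single i 1)

lemma integral_eval_normalLaw {C : Matrix ι ι ℝ} (hC : C.PosSemidef) (i : ι) :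
    ∫ z, z i ∂(normalLaw C) = 0 := by
  simpa using integral_dotProduct_normalLaw hC (Pi.single i 1)

/-- Polarisation of the second moment of linear forms. -/
lemma integral_eval_mul_eval_normalLaw {C : Matrix ι ι ℝ} (hC : C.PosSemidef) (i j : ι) :
    ∫ z, z i * z j ∂(normalLaw C) = C i j := by
  have hi := integral_dotProduct_sq_normalLaw hC (Pi.single i 1)
  have hj := integral_dotProduct_sq_normalLaw hC (Pi.single j 1)
  have hij := integral_dotProduct_sq_normalLaw hC (Pi.single i 1 + Pi.single j 1)
  have hs : C j i = C i j := by
    conv_rhs => rw [← hC.isHermitian]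
    simp
  rw [quadForm_add hC.isHermitian] at hij
  simp only [add_dotProduct, single_one_dotProduct] at hi hj hij
  have e : ∀ z : ι → ℝ, (z i + z j) ^ 2 = z i ^ 2 + 2 * (z i * z j) + z j ^ 2 := fun z => by ring
  have I1 := (memLp_eval_normalLaw hC i).integrable_sq
  have I2 := (memLp_eval_normalLaw hC j).integrable_sq
  have I3 : Integrable (fun z => z i * z j) (normalLaw C) := ((memLp_eval_normalLaw hC i).integrable_mul (memLp_eval_normalLaw hC j))
  have I12 : Integrable (fun z => z i ^ 2 + 2 * (z i * z j)) (normalLaw C) :=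
    I1.add (I3.const_mul 2)
  simp_rw [e] at hij
  rw [integral_add I12 I2, integral_add I1 (I3.const_mul 2),
    integral_const_mul, hi, hj] at hij
  have : (C *ᵥ Pi.single i 1) j = C i j := by simp [hs]
  linarith

lemma dual_prod_apply (φ : StrongDual ℝ ((ι → ℝ) × ℝ)) (v : ι → ℝ) (c : ℝ) :
    φ (v, c) = (fun i => φ (Pi.single i 1, 0)) ⬝ᵥ v + c * φ (0, 1) := by
  have h1 : φ (v, c) = φ (v, 0) + φ (0, c) := by rw [← map_add]; simp
  have h2 := dual_apply_eq_sum (φ.comp (ContinuousLinearMap.inl ℝ (ι → ℝ) ℝ)) v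
  simp only [ContinuousLinearMap.comp_apply, ContinuousLinearMap.inl_apply] at h2
  have h3 : φ (0, c) = c * φ (0, 1) := by
    rw [← smul_eq_mul, ← map_smul]; simp
  rw [h1, h2, h3, dotProduct]

lemma charFunDual_gaussianReal_zero_one (L : StrongDual ℝ ℝ) :
    charFunDual (gaussianReal 0 1) L = Complex.exp ((-(L 1) ^ 2 / 2 : ℝ) : ℂ) := by
  rw [charFunDual_eq_charFun_map_one, gaussianReal_map_continuousLinearMap, charFun_gaussianReal]
  congr 1
  simp [max_eq_left (sq_nonneg (L 1))]
  ring

/-- The parameter `δ` for a covariance matrix with unit variances. -/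
noncomputable def unitDelta (Ω : Matrix ι ι ℝ) (α : ι → ℝ) : ι → ℝ :=
  (√(1 + quadForm Ω α))⁻¹ • (Ω *ᵥ α)

lemma quadForm_vecMulVec (d x : ι → ℝ) : quadForm (Matrix.vecMulVec d d) x = (d ⬝ᵥ x) ^ 2 := by
  rw [quadForm, Matrix.vecMulVec_mulVec]
  simp [dotProduct_comm x d, sq]

lemma posDef_sub_vecMulVec_unitDelta {Ω : Matrix ι ι ℝ} (hΩ : Ω.PosDef) (α : ι → ℝ) :
    (Ω - Matrix.vecMulVec (unitDelta Ω α) (unitDelta Ω α)).PosDef := by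
  refine Matrix.PosDef.of_dotProduct_mulVec_pos (hΩ.isHermitian.sub ?_) fun x hx => ?_
  · rw [Matrix.IsHermitian, Matrix.conjTranspose_vecMulVec]
    simp
  have hq := quadForm_nonneg hΩ.posSemidef α
  set q := quadForm Ω α
  set c := α ⬝ᵥ (Ω *ᵥ x)
  have hd : (unitDelta Ω α ⬝ᵥ x) ^ 2 = c ^ 2 / (1 + q) := by
    have : (Ω *ᵥ α) ⬝ᵥ x = c := by
      rw [dotProduct_comm, dotProduct_mulVec_comm_of_isHermitian hΩ.isHermitian]
    rw [unitDelta, smul_dotProduct, this, smul_eq_mul, mul_pow, inv_pow,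
      Real.sq_sqrt (by positivity)]
    ring
  -- A quantitative Cauchy-Schwarz identity: `c² < (1 + q) xᵀΩx` follows from strict positivity of
  -- the left side, treated separately when `c = 0`.
  have hy : quadForm Ω ((1 + q) • x + (-c) • α) + c ^ 2 =
      (1 + q) * ((1 + q) * quadForm Ω x - c ^ 2) := by
    rw [quadForm_add hΩ.isHermitian, quadForm_smul, quadForm_smul, Matrix.mulVec_smul,
      smul_dotProduct, dotProduct_smul, smul_eq_mul, smul_eq_mul]
    ring
  have hpos : 0 < quadForm Ω ((1 + q) • x + (-c) • α) + c ^ 2 := by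
    have h0 := quadForm_nonneg hΩ.posSemidef ((1 + q) • x + (-c) • α)
    rcases eq_or_ne c 0 with hc | hc
    · rw [hc, neg_zero, zero_smul, add_zero, quadForm_smul]
      have : 0 < quadForm Ω x := by simpa [quadForm] using hΩ.dotProduct_mulVec_pos hx
      positivity
    · positivity
  rw [hy] at hpos
  have h1 := pos_of_mul_pos_right hpos (by positivity)
  have : 0 < quadForm (Ω - Matrix.vecMulVec (unitDelta Ω α) (unitDelta Ω α)) x := by
    rw [sub_eq_add_neg, quadForm_add_matrix, ← neg_one_smul ℝ, quadForm_smul_matrix,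
      quadForm_vecMulVec, hd, neg_one_mul, ← sub_eq_add_neg, sub_pos, div_lt_iff₀ (by positivity)]
    linarith
  simpa [quadForm] using this

/-- The joint law of `(W, (αᵀW - U) / √(1 + αᵀΩα))`, in two coordinate systems. -/
lemma map_prod_normalLaw_eq {Ω : Matrix ι ι ℝ} (hΩ : Ω.PosDef) (α : ι → ℝ) :
    ((normalLaw Ω).prod (gaussianReal 0 1)).map
        (fun p => (p.1, (√(1 + quadForm Ω α))⁻¹ * (α ⬝ᵥ p.1 - p.2))) =
      ((gaussianReal 0 1).prod
        (normalLaw (Ω - Matrix.vecMulVec (unitDelta Ω α) (unitDelta Ω α)))).map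
        (fun p => (p.1 • unitDelta Ω α + p.2, p.1)) := by
  set d := unitDelta Ω α with hd
  set s := (√(1 + quadForm Ω α))⁻¹ with hs
  have hq := quadForm_nonneg hΩ.posSemidef α
  have hs2 : s ^ 2 * (1 + quadForm Ω α) = 1 := by
    rw [hs, inv_pow, Real.sq_sqrt (by positivity), inv_mul_cancel₀ (by positivity)]
  let T : (ι → ℝ) × ℝ →L[ℝ] (ι → ℝ) × ℝ :=
    (ContinuousLinearMap.fst ℝ _ _).prod (s • ((∑ i, α i •
      (ContinuousLinearMap.proj (R := ℝ) (φ := fun _ : ι => ℝ) i)).comp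
        (ContinuousLinearMap.fst ℝ _ _) - ContinuousLinearMap.snd ℝ _ _))
  let R : ℝ × (ι → ℝ) →L[ℝ] (ι → ℝ) × ℝ :=
    ((ContinuousLinearMap.fst ℝ _ _).smulRight d + ContinuousLinearMap.snd ℝ _ _).prod
      (ContinuousLinearMap.fst ℝ _ _)
  have hT : (fun p : (ι → ℝ) × ℝ => (p.1, s * (α ⬝ᵥ p.1 - p.2))) = T := by
    ext p <;> simp [T, dotProduct]
  have hR : (fun p : ℝ × (ι → ℝ) => (p.1 • d + p.2, p.1)) = R := by
    ext p <;> simp [R]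
  have hTa := fun p => (congrFun hT p).symm
  have hRa := fun p => (congrFun hR p).symm
  rw [hT, hR]
  have := Measure.isProbabilityMeasure_map (μ := (normalLaw Ω).prod (gaussianReal 0 1))
    T.continuous.measurable.aemeasurable
  have := Measure.isProbabilityMeasure_map (μ := (gaussianReal 0 1).prod
    (normalLaw (Ω - Matrix.vecMulVec d d))) R.continuous.measurable.aemeasurable
  refine Measure.ext_of_charFunDual ?_
  ext φ
  rw [charFunDual_map, charFunDual_prod, charFunDual_map, charFunDual_prod,
    charFunDual_normalLaw hΩ.posSemidef,
    charFunDual_normalLaw (posDef_sub_vecMulVec_unitDelta hΩ α).posSemidef,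
    charFunDual_gaussianReal_zero_one, charFunDual_gaussianReal_zero_one, ← Complex.exp_add,
    ← Complex.exp_add, ← Complex.ofReal_add, ← Complex.ofReal_add]
  congr 2
  simp only [ContinuousLinearMap.comp_apply, ContinuousLinearMap.inl_apply,
    ContinuousLinearMap.inr_apply]
  set a : ι → ℝ := fun i => φ (Pi.single i 1, 0) with ha
  set b := φ (0, 1)
  have e1 : (fun i => φ (T (Pi.single i 1, 0))) = a + (s * b) • α := by
    ext i
    rw [hTa, dual_prod_apply, ← ha]
    simp [b]
    ring
  have e2 : φ (T (0, 1)) = -(s * b) := by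
    rw [hTa, dual_prod_apply]; simp [b]
  have e3 : φ (R (1, 0)) = a ⬝ᵥ d + b := by
    rw [hRa, dual_prod_apply, ← ha]; simp [b]
  have e4 : (fun i => φ (R (0, Pi.single i 1))) = a := by
    ext i
    rw [hRa, dual_prod_apply, ← ha]
    simp
  rw [e1, e2, e3, e4]
  change -(quadForm Ω (a + (s * b) • α)) / 2 + _ = _ + -(quadForm (Ω - Matrix.vecMulVec d d) a) / 2
  have hda : d ⬝ᵥ a = s * (α ⬝ᵥ (Ω *ᵥ a)) := by
    rw [hd, unitDelta, smul_dotProduct, ← hs, smul_eq_mul, dotProduct_comm (Ω *ᵥ α),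
      dotProduct_mulVec_comm_of_isHermitian hΩ.isHermitian]
  rw [sub_eq_add_neg, quadForm_add_matrix, ← neg_one_smul ℝ (Matrix.vecMulVec d d),
    quadForm_smul_matrix, quadForm_vecMulVec, quadForm_add hΩ.isHermitian, quadForm_smul, smul_dotProduct,
    dotProduct_comm a d, hda, smul_eq_mul]
  -- The exponents differ only in the coefficient of `b²`, where the normalisation of `s` is used.
  linear_combination (-(b ^ 2) / 2) * hs2

/-- The vector skew-normal law with location `0`. -/
noncomputable def skewLaw (Ω : Matrix ι ι ℝ) (α : ι → ℝ) : Measure (ι → ℝ) :=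
  volume.withDensity fun z => ENNReal.ofReal (skewNormalPDF 0 Ω α z)

/-- Twice the restriction of the standard normal law to the half line `[0, ∞)`. -/
noncomputable def halfNormal : Measure ℝ := (2 : ENNReal) • (gaussianReal 0 1).restrict (Set.Ici 0)

instance isFiniteMeasure_halfNormal : IsFiniteMeasure halfNormal := by
  unfold halfNormal
  exact Measure.smul_finite _ (by simp)

lemma stdDev_eq_one {Ω : Matrix ι ι ℝ} (hdiag : ∀ i, Ω i i = 1) : stdDev Ω = 1 := by
  simp [stdDev, hdiag]

/-- The factor `2Φ(αᵀz)` amounts to conditioning `W ∼ N(0, Ω)` on `U ≤ αᵀW` for an independent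
standard normal `U`. In the coordinates of `map_prod_normalLaw_eq` this event is `t ≥ 0`. -/
lemma skewLaw_eq_map {Ω : Matrix ι ι ℝ} (hΩ : Ω.PosDef) (hdiag : ∀ i, Ω i i = 1) (α : ι → ℝ) :
    skewLaw Ω α = (halfNormal.prod
      (normalLaw (Ω - Matrix.vecMulVec (unitDelta Ω α) (unitDelta Ω α)))).map
        fun p => p.1 • unitDelta Ω α + p.2 := by
  set d := unitDelta Ω α
  have hcdf : Measurable fun z : ι → ℝ => cdf (gaussianReal 0 1) (α ⬝ᵥ z) :=
    (monotone_cdf _).measurable.comp (by fun_prop)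
  have h1 : skewLaw Ω α = (normalLaw Ω).withDensity fun z =>
      2 * gaussianReal 0 1 (Set.Iic (α ⬝ᵥ z)) := by
    have hm : Measurable fun z => 2 * gaussianReal 0 1 (Set.Iic (α ⬝ᵥ z)) := by
      simp_rw [← ofReal_cdf]
      fun_prop
    rw [normalLaw_eq_withDensity hΩ, ← withDensity_mul _
      (measurable_normalPDF Ω).ennreal_ofReal hm, skewLaw]
    congr 1
    ext z
    simp only [skewNormalPDF, stdDev_eq_one hdiag, inv_one, Matrix.one_mulVec, sub_zero,
      Pi.mul_apply]
    rw [ENNReal.ofReal_mul (by have := normalPDF_nonneg 0 Ω z; positivity), ofReal_cdf,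
      ENNReal.ofReal_mul zero_le_two, ENNReal.ofReal_ofNat]
    ring
  have hs0 : 0 < (√(1 + quadForm Ω α))⁻¹ := by
    have := quadForm_nonneg hΩ.posSemidef α
    positivity
  have hR : Measurable fun p : ℝ × (ι → ℝ) => (p.1 • d + p.2, p.1) := by fun_prop
  have hT : Measurable fun p : (ι → ℝ) × ℝ =>
      (p.1, (√(1 + quadForm Ω α))⁻¹ * (α ⬝ᵥ p.1 - p.2)) := by fun_prop
  have hadd : Measurable fun p : ℝ × (ι → ℝ) => p.1 • d + p.2 := by fun_prop
  ext A hA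
  have hset : MeasurableSet (A ×ˢ Set.Ici (0 : ℝ)) := hA.prod measurableSet_Ici
  have key := DFunLike.congr_fun (map_prod_normalLaw_eq hΩ α) (A ×ˢ Set.Ici (0 : ℝ))
  rw [Measure.map_apply hT hset, Measure.map_apply hR hset] at key
  have hl : (fun p : (ι → ℝ) × ℝ => (p.1, (√(1 + quadForm Ω α))⁻¹ * (α ⬝ᵥ p.1 - p.2))) ⁻¹'
      (A ×ˢ Set.Ici 0) = {p | p.1 ∈ A ∧ p.2 ≤ α ⬝ᵥ p.1} := by
    ext p
    simp [mul_nonneg_iff_of_pos_left hs0]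
  have hr : (fun p : ℝ × (ι → ℝ) => (p.1 • d + p.2, p.1)) ⁻¹' (A ×ˢ Set.Ici 0) =
      (fun p : ℝ × (ι → ℝ) => p.1 • d + p.2) ⁻¹' A ∩ Set.Ici 0 ×ˢ Set.univ := by
    ext p; simp
  rw [hl, hr] at key
  have hlm : MeasurableSet {p : (ι → ℝ) × ℝ | p.1 ∈ A ∧ p.2 ≤ α ⬝ᵥ p.1} := by
    rw [← hl]; exact hT hset
  rw [Measure.prod_apply hlm] at key
  have hsec : ∀ z, gaussianReal 0 1 (Prod.mk z ⁻¹' {p : (ι → ℝ) × ℝ | p.1 ∈ A ∧ p.2 ≤ α ⬝ᵥ p.1}) =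
      A.indicator (fun z => gaussianReal 0 1 (Set.Iic (α ⬝ᵥ z))) z := by
    intro z
    by_cases hz : z ∈ A <;> simp [hz, Set.Iic, Set.preimage]
  simp_rw [hsec] at key
  rw [lintegral_indicator hA] at key
  rw [h1, withDensity_apply _ hA, lintegral_const_mul' _ _ (by simp), key,
    Measure.map_apply hadd hA, halfNormal, Measure.prod_smul_left, Measure.smul_apply, smul_eq_mul]
  congr 1
  rw [← Measure.restrict_apply (hadd hA), ← Measure.prod_restrict, Measure.restrict_univ]

end SkewLaw

/-! ### The order for skew-normal vectors with unit scale -/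

section VectorOrder

variable {ι : Type*} [Fintype ι] [DecidableEq ι]

lemma memLp_id_halfNormal : MemLp (fun t : ℝ => t) 2 halfNormal :=
  ((memLp_id_gaussianReal (μ := 0) (v := 1) 2).restrict _).smul_measure (by simp)

lemma measurable_smul_add (d : ι → ℝ) :
    Measurable fun p : ℝ × (ι → ℝ) => p.1 • d + p.2 := by fun_prop

/-- The exact mass and mean of `halfNormal` are never needed: the necessity argument only cancels
them as positive factors. -/
lemma halfNormal_real_univ_pos : 0 < halfNormal.real Set.univ := by
  have h0 : halfNormal Set.univ ≠ 0 := by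
    simp only [halfNormal, Measure.smul_apply, Measure.restrict_apply_univ, smul_eq_mul]
    refine mul_ne_zero (by simp) fun h => ?_
    have hac : (volume : Measure ℝ) ≪ gaussianReal 0 1 :=
      gaussianReal_absolutelyContinuous' 0 one_ne_zero
    have := hac h
    simp at this
  exact ENNReal.toReal_pos h0 (measure_ne_top _ _)

lemma integral_halfNormal_pos : 0 < ∫ t, t ∂halfNormal := by
  have hI : Integrable (fun t : ℝ => t) halfNormal := memLp_id_halfNormal.integrable one_le_two
  have hnn : 0 ≤ᵐ[halfNormal] fun t : ℝ => t := by
    refine Measure.ae_smul_measure ?_ _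
    filter_upwards [ae_restrict_mem measurableSet_Ici] with t ht using ht
  rw [integral_pos_iff_support_of_nonneg_ae hnn hI]
  simp only [halfNormal, Measure.smul_apply, smul_eq_mul]
  refine pos_iff_ne_zero.2 (mul_ne_zero (by simp) ?_)
  intro h
  rw [Measure.restrict_apply' measurableSet_Ici] at h
  have hac : (volume : Measure ℝ) ≪ gaussianReal 0 1 :=
      gaussianReal_absolutelyContinuous' 0 one_ne_zero
  have hsub : Set.Ioi (0 : ℝ) ⊆ (Function.support fun t : ℝ => t) ∩ Set.Ici 0 :=
    fun t ht => ⟨ne_of_gt ht, Set.Ioi_subset_Ici_self ht⟩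
  have h2 := measure_mono_null hsub (hac h)
  simp at h2

lemma integral_skewLaw {Ω : Matrix ι ι ℝ} (hΩ : Ω.PosDef) (hdiag : ∀ i, Ω i i = 1) (α : ι → ℝ)
    {h : (ι → ℝ) → ℝ} (hm : Measurable h) :
    ∫ x, h x ∂(skewLaw Ω α) = ∫ p, h (p.1 • unitDelta Ω α + p.2) ∂(halfNormal.prod
      (normalLaw (Ω - Matrix.vecMulVec (unitDelta Ω α) (unitDelta Ω α)))) := by
  rw [skewLaw_eq_map hΩ hdiag, integral_map (measurable_smul_add _).aemeasurable
    hm.aestronglyMeasurable]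

lemma integrable_skewLaw_iff {Ω : Matrix ι ι ℝ} (hΩ : Ω.PosDef) (hdiag : ∀ i, Ω i i = 1)
    (α : ι → ℝ) {h : (ι → ℝ) → ℝ} (hm : Measurable h) :
    Integrable h (skewLaw Ω α) ↔ Integrable (fun p => h (p.1 • unitDelta Ω α + p.2))
      (halfNormal.prod
        (normalLaw (Ω - Matrix.vecMulVec (unitDelta Ω α) (unitDelta Ω α)))) := by
  rw [skewLaw_eq_map hΩ hdiag, integrable_map_measure hm.aestronglyMeasurable
    (measurable_smul_add _).aemeasurable]
  rfl

/-- Fubini reduces to fixed `t`. Since the two `δ` agree, the rank-one terms cancel in the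
difference of covariances, whose diagonal vanishes. -/
lemma integral_skewLaw_le_of_le {Ω Ω' : Matrix ι ι ℝ} (hΩ : Ω.PosDef) (hΩ' : Ω'.PosDef)
    (hdiag : ∀ i, Ω i i = 1) (hdiag' : ∀ i, Ω' i i = 1) {α α' : ι → ℝ}
    (hδ : unitDelta Ω α = unitDelta Ω' α') (hle : ∀ i j, Ω i j ≤ Ω' i j)
    {h : (ι → ℝ) → ℝ} (hh : DirConvex h) (hm : Measurable h)
    (hi : Integrable h (skewLaw Ω α)) (hi' : Integrable h (skewLaw Ω' α')) :
    ∫ x, h x ∂(skewLaw Ω α) ≤ ∫ x, h x ∂(skewLaw Ω' α') := by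
  have hA := posDef_sub_vecMulVec_unitDelta hΩ α
  have hB := posDef_sub_vecMulVec_unitDelta hΩ' α'
  rw [integrable_skewLaw_iff hΩ hdiag α hm] at hi
  rw [integrable_skewLaw_iff hΩ' hdiag' α' hm] at hi'
  rw [integral_skewLaw hΩ hdiag α hm, integral_skewLaw hΩ' hdiag' α' hm, integral_prod _ hi,
    integral_prod _ hi']
  rw [← hδ] at hi' hB ⊢
  refine integral_mono_ae hi.integral_prod_left hi'.integral_prod_left ?_
  filter_upwards [hi.prod_right_ae, hi'.prod_right_ae] with t ht ht'
  exact integral_normalLaw_mono (hh.comp_add_left _) (hm.comp (measurable_const_add _)) hA hB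
    (fun i j => by simpa using hle i j) (fun i => by simp [hdiag, hdiag']) ht ht'

lemma dirConvex_mul_eval (c : ℝ) (i : ι) : DirConvex fun x => c * x i := by
  intro x v w _ _
  simp only [Pi.add_apply]
  linarith

lemma dirConvex_eval_mul_eval (i j : ι) : DirConvex fun x => x i * x j := by
  intro x v w hv hw
  have hvi := hv i
  have hvj := hv j
  have hwi := hw i
  have hwj := hw j
  simp only [Pi.add_apply, Pi.zero_apply] at *
  nlinarith [mul_nonneg hvi hwj, mul_nonneg hvj hwi]

lemma integrable_smul_add_eval {C : Matrix ι ι ℝ} (hC : C.PosSemidef) (d : ι → ℝ) (c : ℝ) (i : ι) :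
    Integrable (fun p : ℝ × (ι → ℝ) => c * (p.1 • d + p.2) i) (halfNormal.prod (normalLaw C)) ∧
    ∫ p, c * (p.1 • d + p.2) i ∂(halfNormal.prod (normalLaw C)) =
      c * (d i * ∫ t, t ∂halfNormal) := by
  have I1 : Integrable (fun p : ℝ × (ι → ℝ) => p.1) (halfNormal.prod (normalLaw C)) :=
    (memLp_id_halfNormal.integrable one_le_two).comp_fst _
  have I2 : Integrable (fun p : ℝ × (ι → ℝ) => p.2 i) (halfNormal.prod (normalLaw C)) :=
    ((memLp_eval_normalLaw hC i).integrable one_le_two).comp_snd _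
  simp only [Pi.add_apply, Pi.smul_apply, smul_eq_mul]
  refine ⟨((I1.mul_const (d i)).add I2).const_mul c, ?_⟩
  rw [integral_const_mul, integral_add (I1.mul_const _) I2, integral_mul_const,
    integral_fun_fst (fun t : ℝ => t), integral_fun_snd (fun z : ι → ℝ => z i),
    integral_eval_normalLaw hC]
  simp [mul_comm]

lemma integrable_smul_add_eval_mul_eval {C : Matrix ι ι ℝ} (hC : C.PosSemidef) (d : ι → ℝ)
    (i j : ι) :
    Integrable (fun p : ℝ × (ι → ℝ) => (p.1 • d + p.2) i * (p.1 • d + p.2) j)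
      (halfNormal.prod (normalLaw C)) ∧
    ∫ p, (p.1 • d + p.2) i * (p.1 • d + p.2) j ∂(halfNormal.prod (normalLaw C)) =
      d i * d j * ∫ t, t ^ 2 ∂halfNormal + halfNormal.real Set.univ * C i j := by
  have ht : Integrable (fun t : ℝ => t) halfNormal := memLp_id_halfNormal.integrable one_le_two
  have hz : ∀ k, Integrable (fun z : ι → ℝ => z k) (normalLaw C) := fun k =>
    (memLp_eval_normalLaw hC k).integrable one_le_two
  have hzz : Integrable (fun z : ι → ℝ => z i * z j) (normalLaw C) :=
    (memLp_eval_normalLaw hC i).integrable_mul (memLp_eval_normalLaw hC j)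
  have I1 : Integrable (fun p : ℝ × (ι → ℝ) => d i * d j * p.1 ^ 2)
      (halfNormal.prod (normalLaw C)) := (memLp_id_halfNormal.integrable_sq.comp_fst _).const_mul _
  have I2 : ∀ k l, Integrable (fun p : ℝ × (ι → ℝ) => d k * (p.1 * p.2 l))
      (halfNormal.prod (normalLaw C)) := fun k l => (ht.mul_prod (hz l)).const_mul _
  have I3 : Integrable (fun p : ℝ × (ι → ℝ) => p.2 i * p.2 j) (halfNormal.prod (normalLaw C)) :=
    hzz.comp_snd _
  have I23 : Integrable (fun p : ℝ × (ι → ℝ) => d i * (p.1 * p.2 j) + d j * (p.1 * p.2 i))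
      (halfNormal.prod (normalLaw C)) := (I2 i j).add (I2 j i)
  have I123 : Integrable (fun p : ℝ × (ι → ℝ) => d i * d j * p.1 ^ 2 +
      (d i * (p.1 * p.2 j) + d j * (p.1 * p.2 i))) (halfNormal.prod (normalLaw C)) := I1.add I23
  have e : (fun p : ℝ × (ι → ℝ) => (p.1 • d + p.2) i * (p.1 • d + p.2) j) = fun p =>
      d i * d j * p.1 ^ 2 + (d i * (p.1 * p.2 j) + d j * (p.1 * p.2 i)) + p.2 i * p.2 j := by
    ext p
    simp only [Pi.add_apply, Pi.smul_apply, smul_eq_mul]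
    ring
  rw [e]
  refine ⟨I123.add I3, ?_⟩
  rw [integral_add I123 I3, integral_add I1 I23, integral_add (I2 i j) (I2 j i),
    integral_const_mul, integral_const_mul, integral_const_mul,
    integral_prod_mul (fun t : ℝ => t) (fun z : ι → ℝ => z j),
    integral_prod_mul (fun t : ℝ => t) (fun z : ι → ℝ => z i),
    integral_fun_fst (fun t : ℝ => t ^ 2), integral_fun_snd (fun z : ι → ℝ => z i * z j),
    integral_eval_normalLaw hC, integral_eval_normalLaw hC, integral_eval_mul_eval_normalLaw hC]
  simp

/-- Characterisation of the directionally convex order of skew-normal vectors with unit scale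
parameters. -/
theorem forall_integral_skewLaw_le_iff {Ω Ω' : Matrix ι ι ℝ} (hΩ : Ω.PosDef) (hΩ' : Ω'.PosDef)
    (hdiag : ∀ i, Ω i i = 1) (hdiag' : ∀ i, Ω' i i = 1) (α α' : ι → ℝ) :
    (∀ h : (ι → ℝ) → ℝ, DirConvex h → Measurable h → Integrable h (skewLaw Ω α) →
      Integrable h (skewLaw Ω' α') → ∫ x, h x ∂(skewLaw Ω α) ≤ ∫ x, h x ∂(skewLaw Ω' α')) ↔
      unitDelta Ω α = unitDelta Ω' α' ∧ ∀ i j, 0 ≤ (Ω' - Ω) i j := by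
  have hA := (posDef_sub_vecMulVec_unitDelta hΩ α).posSemidef
  have hB := (posDef_sub_vecMulVec_unitDelta hΩ' α').posSemidef
  constructor
  · intro H
    -- Linear functions of either sign are admissible, so the means agree; `c = 1` and `c = -1` are
    -- used below.
    have hlin : ∀ (c : ℝ) i, c * unitDelta Ω α i ≤ c * unitDelta Ω' α' i := by
      intro c i
      have hm : Measurable fun x : ι → ℝ => c * x i := by fun_prop
      have a := integrable_smul_add_eval hA (unitDelta Ω α) c i
      have b := integrable_smul_add_eval hB (unitDelta Ω' α') c i
      have := H _ (dirConvex_mul_eval c i) hm ((integrable_skewLaw_iff hΩ hdiag α hm).2 a.1)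
        ((integrable_skewLaw_iff hΩ' hdiag' α' hm).2 b.1)
      rw [integral_skewLaw hΩ hdiag α hm, integral_skewLaw hΩ' hdiag' α' hm, a.2, b.2,
        ← mul_assoc, ← mul_assoc] at this
      exact le_of_mul_le_mul_right this integral_halfNormal_pos
    have hδ : unitDelta Ω α = unitDelta Ω' α' := by
      ext i
      have h1 := hlin 1 i
      have h2 := hlin (-1) i
      linarith
    refine ⟨hδ, fun i j => ?_⟩
    have hm : Measurable fun x : ι → ℝ => x i * x j := by fun_prop
    have a := integrable_smul_add_eval_mul_eval hA (unitDelta Ω α) i j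
    have b := integrable_smul_add_eval_mul_eval hB (unitDelta Ω' α') i j
    have := H _ (dirConvex_eval_mul_eval i j) hm ((integrable_skewLaw_iff hΩ hdiag α hm).2 a.1)
      ((integrable_skewLaw_iff hΩ' hdiag' α' hm).2 b.1)
    rw [integral_skewLaw hΩ hdiag α hm, integral_skewLaw hΩ' hdiag' α' hm, a.2, b.2, ← hδ] at this
    have h2 := le_of_mul_le_mul_left ((add_le_add_iff_left _).1 this) halfNormal_real_univ_pos
    simp only [Matrix.sub_apply] at h2 ⊢
    linarith
  · rintro ⟨hδ, hle⟩ h hh hm hi hi'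
    exact integral_skewLaw_le_of_le hΩ hΩ' hdiag hdiag' hδ
      (fun i j => sub_nonneg.1 (hle i j)) hh hm hi hi'

end VectorOrder

/-! ### Correlation matrices -/

section Correlation

variable {ι : Type*} [Fintype ι] [DecidableEq ι]

lemma inv_stdDev {Ω : Matrix ι ι ℝ} (hΩ : Ω.PosDef) :
    (stdDev Ω)⁻¹ = Matrix.diagonal fun i => (√(Ω i i))⁻¹ := by
  refine Matrix.inv_eq_right_inv ?_
  rw [stdDev, Matrix.diagonal_mul_diagonal, ← Matrix.diagonal_one]
  congr 1
  ext i
  exact mul_inv_cancel₀ (Real.sqrt_pos.2 hΩ.diag_pos).ne'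

lemma corr_apply_self {Ω : Matrix ι ι ℝ} (hΩ : Ω.PosDef) (i : ι) : corr Ω i i = 1 := by
  have h : 0 < Ω i i := hΩ.diag_pos
  rw [corr, inv_stdDev hΩ, Matrix.mul_diagonal, Matrix.diagonal_mul]
  have := Real.mul_self_sqrt h.le
  field_simp
  linarith

lemma posDef_corr {Ω : Matrix ι ι ℝ} (hΩ : Ω.PosDef) : (corr Ω).PosDef := by
  have hT : ((stdDev Ω)⁻¹)ᴴ = (stdDev Ω)⁻¹ := by
    rw [inv_stdDev hΩ, Matrix.diagonal_conjTranspose]; rfl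
  have hinj : Function.Injective ((stdDev Ω)⁻¹).vecMul := by
    refine Matrix.vecMul_injective_of_isUnit ?_
    rw [inv_stdDev hΩ, Matrix.isUnit_diagonal, Pi.isUnit_iff]
    exact fun i => (inv_ne_zero (Real.sqrt_pos.2 hΩ.diag_pos).ne').isUnit
  have := hΩ.mul_mul_conjTranspose_same hinj
  rwa [hT] at this

lemma skewDelta_eq_unitDelta {Ω : Matrix ι ι ℝ} (hdiag : ∀ i, Ω i i = 1) (α : ι → ℝ) :
    skewDelta Ω α = unitDelta Ω α := by
  simp [skewDelta, unitDelta, quadForm, corr, stdDev_eq_one hdiag]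

end Correlation

/-! ### Transfer between matrices and vectors -/

section Vectorization

variable {m n : Type*} [Fintype m] [Fintype n] [DecidableEq m] [DecidableEq n]

/-- The inverse of `Matrix.vec`. -/
def unvec (v : n × m → ℝ) : Matrix m n ℝ := Matrix.of fun i j => v (j, i)

lemma unvec_vec (X : Matrix m n ℝ) : unvec X.vec = X := rfl

lemma vec_unvec (v : n × m → ℝ) : (unvec v).vec = v := rfl

lemma measurable_vec : Measurable fun X : Matrix m n ℝ => X.vec := by
  refine measurable_pi_lambda _ fun p => ?_
  exact (measurable_pi_apply p.1).comp (measurable_pi_apply (X := fun _ : m => n → ℝ) p.2)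

lemma measurable_unvec : Measurable (unvec : (n × m → ℝ) → Matrix m n ℝ) := by
  refine measurable_pi_lambda (X := fun _ : m => n → ℝ) _ fun i => measurable_pi_lambda _ fun j => ?_
  exact measurable_pi_apply (j, i)

/-- Both are product measures; on boxes, vectorisation only reorders the factors. -/
lemma map_vec_volume : (volume : Measure (Matrix m n ℝ)).map (fun X => X.vec) = volume := by
  refine (Measure.pi_eq fun s hs => ?_).symm
  rw [Measure.map_apply measurable_vec (MeasurableSet.univ_pi hs)]
  have : (fun X : Matrix m n ℝ => X.vec) ⁻¹' Set.univ.pi s =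
      Set.univ.pi fun i : m => Set.univ.pi fun j : n => s (j, i) := by
    ext X
    simp only [Set.mem_preimage, Set.mem_pi, Set.mem_univ, true_implies, Prod.forall]
    exact ⟨fun h i _ j _ => h j i, fun h j i => h i trivial j trivial⟩
  rw [this]
  refine (volume_pi_pi (α := fun _ : m => n → ℝ) _).trans ?_
  simp_rw [volume_pi_pi]
  rw [← Finset.univ_product_univ, Finset.prod_product_right]

lemma map_vec_matrixSkewNormal (Ω : Matrix (n × m) (n × m) ℝ) (hdiag : ∀ p, Ω p p = 1)
    (B : Matrix m n ℝ) :
    (matrixSkewNormal 0 Ω B).map (fun X => X.vec) = skewLaw Ω B.vec := by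
  have hd : Measurable fun Y : Matrix m n ℝ =>
      ENNReal.ofReal (skewNormalPDF (0 : Matrix m n ℝ).vec Ω B.vec Y.vec) := by
    have h1 : Measurable fun z : n × m → ℝ => skewNormalPDF 0 Ω B.vec z := by
      have hcdf : Measurable fun z : n × m → ℝ => cdf (gaussianReal 0 1) (B.vec ⬝ᵥ z) :=
        (monotone_cdf _).measurable.comp (by fun_prop)
      simp only [skewNormalPDF, stdDev_eq_one hdiag, inv_one, Matrix.one_mulVec, sub_zero]
      exact ((measurable_normalPDF Ω).const_mul 2).mul hcdf
    exact (h1.comp measurable_vec).ennreal_ofReal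
  rw [matrixSkewNormal, withDensity_map_of_leftInverse measurable_vec measurable_unvec unvec_vec hd,
    map_vec_volume, skewLaw]
  rfl

lemma vec_add_smul_single (X : Matrix m n ℝ) (k : m) (i : n) (ε : ℝ) :
    (X + ε • Matrix.single k i 1).vec = X.vec + Pi.single (i, k) ε := by
  ext ⟨j, l⟩
  simp only [Matrix.vec, Matrix.add_apply, Matrix.smul_apply, Matrix.single_apply, Pi.add_apply,
    Pi.single_apply, Prod.mk.injEq, smul_eq_mul]
  by_cases h1 : k = l <;> by_cases h2 : i = j <;> simp [h1, h2, Ne.symm]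

lemma DirConvex.directionallyConvex_comp_vec {h : (n × m → ℝ) → ℝ} (hh : DirConvex h) :
    DirectionallyConvex fun X : Matrix m n ℝ => h X.vec := by
  intro X k l i j ε δ hε hδ
  have := hh X.vec (Pi.single (i, k) ε) (Pi.single (j, l) δ) (Pi.single_nonneg.2 hε.le)
    (Pi.single_nonneg.2 hδ.le)
  simp only [diffOp, vec_add_smul_single]
  linarith

lemma DirectionallyConvex.dirConvex_comp_unvec {f : Matrix m n ℝ → ℝ}
    (hf : DirectionallyConvex f) : DirConvex fun v => f (unvec v) := by
  refine dirConvex_of_single fun x p q ε δ hε hδ => ?_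
  have hu : ∀ (v : n × m → ℝ) (p : n × m) (ε : ℝ),
      unvec (v + Pi.single p ε) = unvec v + ε • Matrix.single p.2 p.1 1 := fun v p ε => by
    rw [← unvec_vec (unvec v + _), vec_add_smul_single, vec_unvec]
  have := hf (unvec x) p.2 q.2 p.1 q.1 ε δ hε hδ
  simp only [diffOp] at this
  simp only [hu]
  linarith

/-- The directionally convex order of two random matrices only depends on the laws of their
vectorisations. -/
lemma dcxOrder_iff {S T : Type*} [MeasurableSpace S] [MeasurableSpace T] {P : Measure S}
    {Q : Measure T} {X : S → Matrix m n ℝ} {Y : T → Matrix m n ℝ} {μ ν : Measure (n × m → ℝ)}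
    (hX : AEMeasurable X P) (hY : AEMeasurable Y Q)
    (hμ : (P.map X).map (fun X => X.vec) = μ) (hν : (Q.map Y).map (fun X => X.vec) = ν) :
    DcxOrder X P Y Q ↔ ∀ h : (n × m → ℝ) → ℝ, DirConvex h → Measurable h → Integrable h μ →
      Integrable h ν → ∫ x, h x ∂μ ≤ ∫ x, h x ∂ν := by
  have hXv : AEMeasurable (fun s => (X s).vec) P := measurable_vec.comp_aemeasurable hX
  have hYv : AEMeasurable (fun s => (Y s).vec) Q := measurable_vec.comp_aemeasurable hY
  have hμ' : P.map (fun s => (X s).vec) = μ := by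
    rw [← hμ, AEMeasurable.map_map_of_aemeasurable measurable_vec.aemeasurable hX]; rfl
  have hν' : Q.map (fun s => (Y s).vec) = ν := by
    rw [← hν, AEMeasurable.map_map_of_aemeasurable measurable_vec.aemeasurable hY]; rfl
  subst hμ' hν'
  constructor
  · intro H h hh hm hi hi'
    rw [integrable_map_measure hm.aestronglyMeasurable hXv] at hi
    rw [integrable_map_measure hm.aestronglyMeasurable hYv] at hi'
    rw [integral_map hXv hm.aestronglyMeasurable, integral_map hYv hm.aestronglyMeasurable]
    exact H _ hh.directionallyConvex_comp_vec (hm.comp measurable_vec) hi hi'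
  · intro H f hf hm hi hi'
    have hm' : Measurable fun v => f (unvec v) := hm.comp measurable_unvec
    have := H _ (DirectionallyConvex.dirConvex_comp_unvec hf) hm'
      ((integrable_map_measure hm'.aestronglyMeasurable hXv).2 hi)
      ((integrable_map_measure hm'.aestronglyMeasurable hYv).2 hi')
    rwa [integral_map hXv hm'.aestronglyMeasurable, integral_map hYv hm'.aestronglyMeasurable]
      at this

end Vectorization

end SkewNormal

/-! ### The matrix variate theorem -/

theorem mainTheorem8 {n p : ℕ}
    (V V' : Matrix (Fin p) (Fin p) ℝ) (Sig Sig' : Matrix (Fin n) (Fin n) ℝ)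
    (hV : V.PosDef) (hV' : V'.PosDef) (hSig : Sig.PosDef) (hSig' : Sig'.PosDef)
    (δ δ' : Fin p × Fin n → ℝ)
    {S T : Type*} [MeasurableSpace S] [MeasurableSpace T]
    (P : Measure S) [IsProbabilityMeasure P] (Q : Measure T) [IsProbabilityMeasure Q]
    (X₀ : S → Matrix (Fin n) (Fin p) ℝ) (Y₀ : T → Matrix (Fin n) (Fin p) ℝ)
    (hX₀ : SkewNormal.IsMatrixSkewNormal X₀ P 0 (SkewNormal.corr (V ⊗ₖ Sig)) δ)
    (hY₀ : SkewNormal.IsMatrixSkewNormal Y₀ Q 0 (SkewNormal.corr (V' ⊗ₖ Sig')) δ') :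
    SkewNormal.DcxOrder X₀ P Y₀ Q ↔
      δ = δ' ∧ ∀ a b : Fin p × Fin n,
        0 ≤ (SkewNormal.corr (V' ⊗ₖ Sig') - SkewNormal.corr (V ⊗ₖ Sig)) a b := by
  have hΩ := hV.kronecker hSig
  have hΩ' := hV'.kronecker hSig'
  have hdiag := SkewNormal.corr_apply_self hΩ
  have hdiag' := SkewNormal.corr_apply_self hΩ'
  obtain ⟨B, hX, rfl⟩ := hX₀
  obtain ⟨B', hY, rfl⟩ := hY₀
  rw [SkewNormal.skewDelta_eq_unitDelta hdiag, SkewNormal.skewDelta_eq_unitDelta hdiag',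
    ← SkewNormal.forall_integral_skewLaw_le_iff (SkewNormal.posDef_corr hΩ)
      (SkewNormal.posDef_corr hΩ') hdiag hdiag']
  refine SkewNormal.dcxOrder_iff hX.aemeasurable hY.aemeasurable ?_ ?_
  · rw [hX.map_eq, SkewNormal.map_vec_matrixSkewNormal _ hdiag]
  · rw [hY.map_eq, SkewNormal.map_vec_matrixSkewNormal _ hdiag']
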